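/- Let $\mathcal{G}=(V,\mathcal{E})$ be a finite hypergraph (parallel hyperedges allowed, every hyperedge has at least two vertices), let $h,k$ be positive integers, $K=\{1,\dots,k\}$, and let $\ell,\ell':K\cup\{0\}\to\mathbb{Z}_{>0}$ satisfy $$\sum_{i\in K}\ell'(i)\ \ge\ \ell'(0)\ \ge\ \ell(0)\ \ge\ \sum_{i\in K}\ell(i),\qquad |V|\ \ge\ \ell'(i)\ \ge\ \ell(i)\ \text{ for every } i\in K.$$ Definitions. A digraph $(U,F)$ is an $S$-branching if $S\subseteq U$ and there is a unique directed path from $S$ to every $u\in U$ (so it is a disjoint union of arborescences whose roots are the vertices of $S$). A hyperarc has one head and at least one tail. A directed hypergraph $\mathcal{B}=(U,\mathcal{F})$ is an $S$-hyperbranching if $S\subseteq U$ and each hyperarc can be replaced by an arc from one of its tails to its head so that the resulting arcs form an $S$-branching on the vertex set consisting of $S$ and all heads of hyperarcs in $\mathcal{F}$; this vertex set is the core of $\mathcal{B}$. A hypergraph is an $S$-hyperforest if one can choose a head in each of its hyperedges (the other vertices becoming tails) so that an $S$-hyperbranching is obtained. An $h$-regular packing of $k$ $S_i$-hyperforests in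 $\mathcal{G}$ is a family $B_1,\dots,B_k$ of pairwise hyperedge-disjoint subhypergraphs of $\mathcal{G}$, where $B_i$ is an $S_i$-hyperforest, such that the $B_i$ can be oriented to $S_i$-hyperbranchings for which every vertex of $\mathcal{G}$ belongs to exactly $h$ of the $k$ cores. For a partition $\mathcal{P}$ of $V$ into non-empty classes, $e_{\mathcal{E}}(\mathcal{P})$ is the number of hyperedges that intersect at least two members of $\mathcal{P}$. Then there exist sets $S_1,\dots,S_k\subseteq V$ and an $h$-regular packing of $k$ $S_i$-hyperforests in $\mathcal{G}$ with $$\ell(i)\le |S_i|\le \ell'(i)\ \text{ for every } i\in K,\qquad \ell(0)\le\sum_{i=1}^k|S_i|\le\ell'(0)$$ if and only if $h|V|\ge \ell(0)$ and, for every partition $\mathcal{P}$ of $V$, $$\ell'(0)-\sum_{i\in K}\ell(i)+\sum_{i\in K}\min\{\ell(i),|\mathcal{P}|\}+e_{\mathcal{E}}(\mathcal{P})\ \ge\ h|\mathcal{P}|,$$ $$\sum_{i\in K}\min\{\ell'(i),|\mathcal{P}|\}+e_{\mathcal{E}}(\mathcal{P})\ \ge\ h|\mathcal{P}|.$$ 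-/

import Mathlib

/-- A finite hypergraph with vertices from `V` and hyperedges labelled by elements of `ε`
(parallel hyperedges are allowed). Every hyperedge consists of at least two vertices.
The value of `ends` outside `edges` is irrelevant. -/
structure FinHypergraph (V ε : Type*) where
  verts : Finset V
  edges : Finset ε
  ends : ε → Finset V
  ends_subset : ∀ e ∈ edges, ends e ⊆ verts
  two_le_card : ∀ e ∈ edges, 2 ≤ (ends e).card

/-- A finite directed hypergraph (dypergraph): every hyperarc has exactly one head and at least
one tail. The values of `head` and `tails` outside `arcs` are irrelevant. -/
structure FinDypergraph (V ε : Type*) where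
  verts : Finset V
  arcs : Finset ε
  head : ε → V
  tails : ε → Finset V
  head_mem : ∀ a ∈ arcs, head a ∈ verts
  tails_subset : ∀ a ∈ arcs, tails a ⊆ verts
  tails_nonempty : ∀ a ∈ arcs, (tails a).Nonempty
  head_notMem_tails : ∀ a ∈ arcs, head a ∉ tails a

/-- `IsDipathTo S A tail head v p`: the list `p`, read from its last entry to its first, is the
arc sequence of a directed path that starts in `S`, uses arcs of `A` only, and ends at `v`.
Vertices may be repeated; this makes uniqueness exclude circuits as well. -/
def IsDipathTo {V ε : Type*} (S : Finset V) (A : Finset ε) (tail head : ε → V) :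
    V → List ε → Prop
  | v, [] => v ∈ S
  | v, a :: p => a ∈ A ∧ head a = v ∧ IsDipathTo S A tail head (tail a) p

/-- The digraph with vertex set `U` and arc set `A`, where `a ∈ A` goes from `tail a` to `head a`,
is a branching with root set `S`: there is a unique directed path from `S` to every vertex. -/
def IsBranching {V ε : Type*} (U : Finset V) (A : Finset ε) (tail head : ε → V)
    (S : Finset V) : Prop :=
  S ⊆ U ∧ (∀ a ∈ A, tail a ∈ U ∧ head a ∈ U) ∧
    ∀ v ∈ U, ∃! p : List ε, IsDipathTo S A tail head v p

namespace FinDypergraph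

variable {V ε : Type*} [DecidableEq V]

/-- The vertices of in-degree at least one, together with the vertices of `S`. -/
def core (D : FinDypergraph V ε) (S : Finset V) : Finset V :=
  D.arcs.image D.head ∪ S

/-- `D` is a hyperbranching with root set `S`: every hyperarc can be trimmed to an arc from one of
its tails to its head so that the arcs form an `S`-branching on the core. -/
def IsHyperbranching (D : FinDypergraph V ε) (S : Finset V) : Prop :=
  S ⊆ D.verts ∧ ∃ tail : ε → V, (∀ a ∈ D.arcs, tail a ∈ D.tails a) ∧
    IsBranching (D.core S) D.arcs tail D.head S

end FinDypergraph

namespace FinHypergraph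

variable {V ε : Type*} [DecidableEq V]

/-- `D` is obtained from `G` by choosing in every hyperedge a vertex as its head; the other
vertices of the hyperedge become its tails. -/
def IsOrientation (G : FinHypergraph V ε) (D : FinDypergraph V ε) : Prop :=
  D.verts = G.verts ∧ D.arcs = G.edges ∧
    ∀ e ∈ G.edges, D.head e ∈ G.ends e ∧ D.tails e = (G.ends e).erase (D.head e)

/-- `T` is a hyperforest with root set `S`. -/
def IsHyperforest (T : FinHypergraph V ε) (S : Finset V) : Prop :=
  ∃ D : FinDypergraph V ε, T.IsOrientation D ∧ D.IsHyperbranching S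

/-- `B` is a subhypergraph of `G`. -/
def IsSubhypergraph (B G : FinHypergraph V ε) : Prop :=
  B.verts ⊆ G.verts ∧ B.edges ⊆ G.edges ∧ ∀ e ∈ B.edges, B.ends e = G.ends e

/-- The number of hyperedges of `G` that enter some member of the partition `P` of the vertex set,
where a hyperedge enters `X` if it has a vertex in `X` and a vertex outside `X`. -/
def crossing (G : FinHypergraph V ε) (P : Finpartition G.verts) : ℕ :=
  (G.edges.filter fun e => ∃ X ∈ P.parts, (G.ends e ∩ X).Nonempty ∧ (G.ends e \ X).Nonempty).card

/-- `B 0, …, B (k - 1)` is an `h`-regular packing of `S i`-hyperforests in `G`: the `B i` are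
pairwise hyperedge-disjoint subhypergraphs of `G`, each `B i` is an `S i`-hyperforest, and they
can be oriented to `S i`-hyperbranchings so that every vertex of `G` belongs to exactly `h`
of their cores. -/
structure IsRegularPacking (G : FinHypergraph V ε) (h : ℕ) {k : ℕ}
    (B : Fin k → FinHypergraph V ε) (S : Fin k → Finset V) : Prop where
  sub : ∀ i, (B i).IsSubhypergraph G
  disjoint : ∀ i j, i ≠ j → Disjoint (B i).edges (B j).edges
  hyperforest : ∀ i, (B i).IsHyperforest (S i)
  regular : ∃ D : Fin k → FinDypergraph V ε,
    (∀ i, (B i).IsOrientation (D i) ∧ (D i).IsHyperbranching (S i)) ∧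
    ∀ v ∈ G.verts, (Finset.univ.filter fun i => v ∈ (D i).core (S i)).card = h

end FinHypergraph

/-!
For necessity, count for every member `X` of a partition the colours that reach `X`: each vertex
lies in `h` cores, so at least `h` colours have a root in `X` or a hyperarc entering `X`. A colour
`i` has roots in at most `min |S i| |P|` members, and a hyperarc enters at most one of them.

For sufficiency, first fix the sizes `|S i|`. A vector between the bounds `ℓ` and `ℓ'` that is as
level as its sum permits maximises all the sums `∑ i, min |S i| p` at once, which reduces both
partition conditions to the single one `h |P| ≤ ∑ i, min |S i| |P| + crossing P`.

Call the number of colours missing in `X` plus the number of hyperedges inside `X` the demand of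
`X`. It is intersecting supermodular, so an orientation in which every set `X` contains at least as
many heads as it demands exists as soon as no partition has total demand above the number of
hyperedges. The largest total demand is a supermodular function of the set of coloured roots, so
the theorem of Rado finds roots for which this bound holds. Every set is then entered by as many
hyperarcs as it lacks colours. This cut condition survives moving roots from vertices with more than
`h` colours to vertices with fewer, and then the argument of Lovász for packing branchings applies:
inside a minimal critical set some hyperarc can be traded for a root at its head, of a colour
present at one of its tails, without violating the cut condition.
-/

/-! ### Sizes of the root sets -/

section Sizes

open Finset

variable {K : Type*} [Fintype K] {l l' n : K → ℕ} {h L L' N t : ℕ}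

theorem exists_levelled_sum_eq (hl : ∀ i, l i ≤ l' i) (T : ℕ)
    (hT : ∑ i, l i ≤ T) (hT' : T ≤ ∑ i, l' i) :
    ∃ (n : K → ℕ) (τ : ℕ), (∀ i, l i ≤ n i ∧ n i ≤ l' i) ∧ ∑ i, n i = T ∧
      ∀ i, min (l' i) τ ≤ n i ∧ n i ≤ max (l i) (τ + 1) := by
  classical
  induction T, hT using Nat.le_induction with
  | base => exact ⟨l, 0, fun i => ⟨le_rfl, hl i⟩, rfl, fun i => ⟨by simp, le_max_left _ _⟩⟩
  | succ T _ ih =>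
    obtain ⟨n, τ, hbounds, hsum, hlevel⟩ := ih (by omega)
    obtain ⟨j, -, hj⟩ : ∃ j ∈ univ, n j < l' j := exists_lt_of_sum_lt (by omega)
    -- raising a smallest entry that is not yet at its upper bound keeps the vector levelled
    obtain ⟨i, hi, hmin⟩ := exists_min_image {i | n i < l' i} n ⟨j, by simpa using hj⟩
    simp only [mem_filter, mem_univ, true_and] at hi hmin
    refine ⟨Function.update n i (n i + 1), n i, fun j => ?_, ?_, fun j => ?_⟩
    · have := hbounds j
      by_cases hj : j = i
      · subst hj
        simp only [Function.update_self]
        omega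
      · simpa only [Function.update_of_ne hj]
    · rw [sum_update_of_mem (mem_univ i), ← hsum, ← add_sum_erase _ _ (mem_univ i),
        sdiff_singleton_eq_erase]
      omega
    · have := hlevel j
      have := hlevel i
      by_cases hj : j = i
      · subst hj
        simp only [Function.update_self]
        omega
      · simp only [Function.update_of_ne hj]
        have := hbounds j
        have := hmin j
        omega

theorem mul_le_sum_min (hn : ∀ i, n i ≤ N) (ht : t ≤ N) (hsum : h * N ≤ ∑ i, n i) :
    h * t ≤ ∑ i, min (n i) t := by
  obtain rfl | hN := N.eq_zero_or_pos
  · simp [Nat.le_zero.1 ht]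
  refine Nat.le_of_mul_le_mul_left ?_ hN
  calc N * (h * t) = h * N * t := by ring
    _ ≤ ∑ i, n i * t := by rw [← sum_mul]; gcongr
    _ ≤ ∑ i, N * min (n i) t := sum_le_sum fun i _ => ?_
    _ = N * ∑ i, min (n i) t := (mul_sum ..).symm
  rcases le_total (n i) t with h | h
  · rw [min_eq_left h, mul_comm]
    gcongr
  · rw [min_eq_right h]
    gcongr
    exact hn i

theorem sum_min_add_sum_le (hl : ∀ i, l i ≤ n i) :
    ∑ i, min (n i) t + ∑ i, l i ≤ ∑ i, min (l i) t + ∑ i, n i := by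
  rw [← sum_add_distrib, ← sum_add_distrib]
  exact sum_le_sum fun i _ => by have := hl i; omega

theorem sum_min_add_sum_eq (hl : ∀ i, l i ≤ n i) (hn : ∀ i, n i ≤ max (l i) t) :
    ∑ i, min (n i) t + ∑ i, l i = ∑ i, min (l i) t + ∑ i, n i := by
  rw [← sum_add_distrib, ← sum_add_distrib]
  exact sum_congr rfl fun i _ => by have := hl i; have := hn i; omega

theorem exists_sizes_iff {ι : Type*} {p e : ι → ℕ} (hl : ∀ i, l i ≤ l' i) (hN : ∀ i, l' i ≤ N)
    (hp : ∀ a, p a ≤ N) (hL : ∑ i, l i ≤ L) (hLL' : L ≤ L') (hL' : L' ≤ ∑ i, l' i) :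
    (∃ n : K → ℕ, (∀ i, l i ≤ n i ∧ n i ≤ l' i) ∧ L ≤ ∑ i, n i ∧ ∑ i, n i ≤ L' ∧
        ∑ i, n i ≤ h * N ∧ ∀ a, h * p a ≤ ∑ i, min (n i) (p a) + e a) ↔
      L ≤ h * N ∧ (∀ a, h * p a + ∑ i, l i ≤ L' + ∑ i, min (l i) (p a) + e a) ∧
        ∀ a, h * p a ≤ ∑ i, min (l' i) (p a) + e a := by
  constructor
  · rintro ⟨n, hn, hlow, hupp, hnN, hcross⟩
    refine ⟨hlow.trans hnN, fun a => ?_, fun a => (hcross a).trans ?_⟩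
    · have := hcross a
      have := sum_min_add_sum_le (t := p a) fun i => (hn i).1
      omega
    · gcongr with i
      exact (hn i).2
  · rintro ⟨hLN, hlower, hupper⟩
    obtain ⟨n, τ, hn, hsum, hlevel⟩ :=
      exists_levelled_sum_eq hl (min L' (h * N)) (by omega) (by omega)
    refine ⟨n, hn, by omega, by omega, by omega, fun a => ?_⟩
    rcases le_total (h * N) L' with hN' | hL'N
    · have := mul_le_sum_min (fun i => (hn i).2.trans (hN i)) (hp a) (by omega : h * N ≤ _)
      omega
    rcases le_or_gt (p a) τ with hτ | hτ
    · refine (hupper a).trans (Nat.add_le_add_right (sum_le_sum fun i _ => ?_) _)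
      have := (hlevel i).1
      omega
    · have := sum_min_add_sum_eq (t := p a) (fun i => (hn i).1)
        fun i => (hlevel i).2.trans (by gcongr; omega)
      have := hlower a
      omega

end Sizes

/-! ### Submodular functions and Rado's theorem -/

section Submodular

open Finset

variable {N : Type*} [DecidableEq N]

theorem submodular_of_insert {α : Type*} [CommRing α] [LinearOrder α] [IsStrictOrderedRing α]
    {f : Finset N → α}
    (hf : ∀ R a b, f R + f (insert a (insert b R)) ≤ f (insert a R) + f (insert b R))
    (A B : Finset N) : f (A ∪ B) + f (A ∩ B) ≤ f A + f B := by
  have marginal_le (a : N) (R T : Finset N) :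
      f (insert a (T ∪ R)) + f R ≤ f (T ∪ R) + f (insert a R) := by
    induction T using Finset.induction_on with
    | empty => simp [add_comm]
    | insert b T _ ih =>
      rw [insert_union]
      linarith [hf (T ∪ R) a b]
  have union_le (C T : Finset N) (hC : C ⊆ A) : f (A ∪ T) + f C ≤ f A + f (C ∪ T) := by
    induction T using Finset.induction_on with
    | empty => simp
    | insert b T _ ih =>
      have := marginal_le b (C ∪ T) A
      rw [← union_assoc, union_eq_left.2 hC] at this
      rw [union_insert, union_insert]
      linarith
  have := union_le (A ∩ B) B inter_subset_left
  rw [union_eq_right.2 inter_subset_right] at this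
  linarith

variable {ι : Type*} {f : Finset N → ℤ} {A : ι → Finset N}

theorem rado_erase_or_erase [DecidableEq ι] (hmono : Monotone f)
    (hsub : ∀ X Y, f (X ∪ Y) + f (X ∩ Y) ≤ f X + f Y)
    (hA : ∀ J : Finset ι, (#J : ℤ) ≤ f (J.biUnion A)) {i : ι} {x y : N}
    (hx : x ∈ A i) (hxy : x ≠ y) :
    (∀ J : Finset ι, (#J : ℤ) ≤ f (J.biUnion (Function.update A i ((A i).erase x)))) ∨
      ∀ J : Finset ι, (#J : ℤ) ≤ f (J.biUnion (Function.update A i ((A i).erase y))) := by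
  set A' : N → ι → Finset N := fun z => Function.update A i ((A i).erase z)
  have mem_A' {z w : N} {j : ι} : w ∈ A' z j ↔ w ∈ A j ∧ (j = i → w ≠ z) := by
    by_cases hj : j = i
    · subst hj; simp [A', and_comm]
    · simp [A', hj]
  by_contra! ⟨⟨J₁, h₁⟩, ⟨J₂, h₂⟩⟩
  change f (J₁.biUnion (A' x)) < #J₁ at h₁
  change f (J₂.biUnion (A' y)) < #J₂ at h₂
  have mem_of_lt {z : N} {J : Finset ι} (hJ : f (J.biUnion (A' z)) < #J) : i ∈ J := by
    by_contra hi
    refine (hA J).not_gt ((congrArg f (biUnion_congr rfl fun j hj => ?_)).trans_lt hJ)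
    exact (Function.update_of_ne (ne_of_mem_of_not_mem hj hi) ..).symm
  have hi₁ := mem_of_lt h₁
  have hi₂ := mem_of_lt h₂
  have hunion : (J₁ ∪ J₂).biUnion A ⊆ J₁.biUnion (A' x) ∪ J₂.biUnion (A' y) := by
    intro z hz
    simp only [mem_biUnion, mem_union, mem_A'] at hz ⊢
    grind
  have hinter : ((J₁ ∩ J₂).erase i).biUnion A ⊆ J₁.biUnion (A' x) ∩ J₂.biUnion (A' y) := by
    intro z hz
    simp only [mem_biUnion, mem_erase, mem_inter, mem_A'] at hz ⊢
    grind
  have := hmono hunion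
  have := hmono hinter
  have := hsub (J₁.biUnion (A' x)) (J₂.biUnion (A' y))
  have := hA (J₁ ∪ J₂)
  have := hA ((J₁ ∩ J₂).erase i)
  have := card_union_add_card_inter J₁ J₂
  have := card_erase_add_one (mem_inter.2 ⟨hi₁, hi₂⟩)
  omega

/-- **Rado's theorem** for a monotone submodular function. -/
theorem exists_transversal_of_submodular [Finite ι] (hmono : Monotone f)
    (hsub : ∀ X Y, f (X ∪ Y) + f (X ∩ Y) ≤ f X + f Y) (hne : ∀ i, (A i).Nonempty)
    (hA : ∀ J : Finset ι, (#J : ℤ) ≤ f (J.biUnion A)) :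
    ∃ x : ι → N, (∀ i, x i ∈ A i) ∧ ∀ J : Finset ι, (#J : ℤ) ≤ f (J.image x) := by
  classical
  obtain ⟨B, hBA, ⟨hBne, hB⟩, hmin⟩ := exists_minimal_le_of_wellFoundedLT
    (fun A : ι → Finset N => (∀ i, (A i).Nonempty) ∧
      ∀ J : Finset ι, (#J : ℤ) ≤ f (J.biUnion A)) A ⟨hne, hA⟩
  have erase_rado_imp {i : ι} {x : N} (hx : x ∈ B i) (hnt : (B i).Nontrivial) :
      ¬∀ J : Finset ι, (#J : ℤ) ≤ f (J.biUnion (Function.update B i ((B i).erase x))) := by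
    intro hJ
    have hle : Function.update B i ((B i).erase x) ≤ B :=
      update_le_self_iff.2 (erase_subset _ _)
    have hnot : x ∉ Function.update B i ((B i).erase x) i := by simp
    refine hnot (hmin ⟨fun j => ?_, hJ⟩ hle i hx)
    by_cases hj : j = i
    · subst hj
      simpa using hnt.erase_nonempty
    · simpa [hj] using hBne j
  have subsingleton (i : ι) : ¬(B i).Nontrivial := by
    rintro hnt
    obtain ⟨x, hx, y, hy, hxy⟩ := hnt
    rcases rado_erase_or_erase hmono hsub hB hx hxy with h | h
    · exact erase_rado_imp hx ⟨x, hx, y, hy, hxy⟩ h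
    · exact erase_rado_imp hy ⟨x, hx, y, hy, hxy⟩ h
  choose x hx using fun i => (hBne i)
  refine ⟨x, fun i => hBA i (hx i), fun J => (hB J).trans (hmono fun z hz => ?_)⟩
  obtain ⟨i, hi, hz⟩ := mem_biUnion.1 hz
  have : z = x i := by
    by_contra hne
    exact subsingleton i ⟨z, hz, x i, hx i, hne⟩
  exact this ▸ mem_image_of_mem x hi

end Submodular

/-! ### Covering vectors of intersecting supermodular functions -/

section Supermodular

open Finset

variable {V : Type*} {U : Finset V} {q : Finset V → ℕ} {m : V → ℕ}

/-- The vector `m` dominates `q` on the non-empty subsets of `U`. For an intersecting supermodular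
`q` these are the integer points of a contrapolymatroid. -/
def Covers (U : Finset V) (q : Finset V → ℕ) (m : V → ℕ) : Prop :=
  ∀ X ⊆ U, X.Nonempty → q X ≤ ∑ v ∈ X, m v

theorem exists_minimalFor_covers (U : Finset V) (q : Finset V → ℕ) :
    ∃ m, MinimalFor (Covers U q) (fun m => ∑ v ∈ U, m v) m := by
  refine exists_minimalFor_of_wellFoundedLT _ _ ⟨fun _ => U.powerset.sup q, ?_⟩
  rintro X hX ⟨v, hv⟩
  exact (le_sup (mem_powerset.2 hX)).trans
    (single_le_sum (f := fun _ => U.powerset.sup q) (fun _ _ => Nat.zero_le _) hv)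

theorem exists_tight_of_minimalFor_covers
    (hm : MinimalFor (Covers U q) (fun m => ∑ v ∈ U, m v) m) {v : V} (hv : v ∈ U) :
    ∃ X ⊆ U, v ∈ X ∧ ∑ w ∈ X, m w = q X := by
  classical
  by_contra! hno
  have hlt (X : Finset V) (hX : X ⊆ U) (hvX : v ∈ X) : q X < ∑ w ∈ X, m w :=
    lt_of_le_of_ne (hm.1 X hX ⟨v, hvX⟩) (hno X hX hvX).symm
  have hpos : 0 < m v := by
    simpa using (Nat.zero_le _).trans_lt (hlt {v} (by simpa) (by simp))
  have hsum (X : Finset V) (hvX : v ∈ X) :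
      ∑ w ∈ X, Function.update m v (m v - 1) w + 1 = ∑ w ∈ X, m w := by
    rw [sum_update_of_mem hvX, ← add_sum_erase X m hvX, sdiff_singleton_eq_erase]
    omega
  have hcovers : Covers U q (Function.update m v (m v - 1)) := by
    intro X hX hne
    by_cases hvX : v ∈ X
    · have := hsum X hvX
      have := hlt X hX hvX
      omega
    · rw [sum_update_of_notMem hvX]
      exact hm.1 X hX hne
  have := hsum U hv
  have hle : ∑ w ∈ U, m w ≤ ∑ w ∈ U, Function.update m v (m v - 1) w :=
    hm.2 hcovers (Nat.le_of_succ_le this.le)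
  omega

variable [DecidableEq V]

/-- Supermodularity of `q` on the pairs of intersecting subsets of `U`. -/
def IntersectingSupermodular (q : Finset V → ℕ) (U : Finset V) : Prop :=
  ∀ X ⊆ U, ∀ Y ⊆ U, (X ∩ Y).Nonempty → q X + q Y ≤ q (X ∪ Y) + q (X ∩ Y)

/-- The largest total value of `q` on the classes of a partition of `U`. For an intersecting
supermodular `q` this is the value at `U` of the upper truncation of `q`. -/
def maxPartitionSum (q : Finset V → ℕ) (U : Finset V) : ℕ :=
  univ.sup fun P : Finpartition U => ∑ X ∈ P.parts, q X

theorem sum_parts_le_maxPartitionSum (q : Finset V → ℕ) (P : Finpartition U) :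
    ∑ X ∈ P.parts, q X ≤ maxPartitionSum q U :=
  le_sup (f := fun P : Finpartition U => ∑ X ∈ P.parts, q X) (mem_univ P)

theorem exists_sum_parts_eq_maxPartitionSum (q : Finset V → ℕ) (U : Finset V) :
    ∃ P : Finpartition U, ∑ X ∈ P.parts, q X = maxPartitionSum q U := by
  obtain ⟨P, -, hP⟩ := exists_mem_eq_sup univ ⟨⊥, mem_univ _⟩
    fun P : Finpartition U => ∑ X ∈ P.parts, q X
  exact ⟨P, hP.symm⟩

theorem sum_parts_sum_eq {M : Type*} [AddCommMonoid M] (P : Finpartition U) (f : V → M) :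
    ∑ X ∈ P.parts, ∑ v ∈ X, f v = ∑ v ∈ U, f v := by
  conv_rhs => rw [← P.biUnion_parts]
  exact (sum_biUnion P.disjoint).symm

theorem Covers.tight_union (hq : IntersectingSupermodular q U) (hm : Covers U q m)
    {X Y : Finset V} (hX : X ⊆ U) (hY : Y ⊆ U) (hXY : (X ∩ Y).Nonempty)
    (hXt : ∑ v ∈ X, m v = q X) (hYt : ∑ v ∈ Y, m v = q Y) :
    ∑ v ∈ X ∪ Y, m v = q (X ∪ Y) := by
  have := hq X hX Y hY hXY
  have := hm (X ∩ Y) (inter_subset_left.trans hX) hXY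
  have := hm (X ∪ Y) (union_subset hX hY) (hXY.mono (inter_subset_left.trans subset_union_left))
  have := sum_union_inter (s₁ := X) (s₂ := Y) (f := m)
  omega

theorem exists_finpartition_of_union_mem {F : Finset (Finset V)} (hF : ∀ X ∈ F, X ⊆ U)
    (hempty : ∅ ∉ F) (hcover : ∀ v ∈ U, ∃ X ∈ F, v ∈ X)
    (hunion : ∀ X ∈ F, ∀ Y ∈ F, (X ∩ Y).Nonempty → X ∪ Y ∈ F) :
    ∃ P : Finpartition U, P.parts ⊆ F ∧ ∀ X ∈ F, ∃ Y ∈ P.parts, X ⊆ Y := by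
  classical
  have eq_of_maximal {X Y : Finset V} (hX : Maximal (· ∈ F) X) (hY : Maximal (· ∈ F) Y)
      (hXY : (X ∩ Y).Nonempty) : X = Y :=
    (hX.eq_of_le (hunion X hX.1 Y hY.1 hXY) subset_union_left).trans
      (hY.eq_of_le (hunion X hX.1 Y hY.1 hXY) subset_union_right).symm
  refine ⟨.ofExistsUnique {X ∈ F | Maximal (· ∈ F) X} (fun X hX => hF X (mem_filter.1 hX).1)
    (fun v hv => ?_) (fun h => hempty (mem_filter.1 h).1), filter_subset _ _, fun X hX => ?_⟩
  · obtain ⟨X, hX, hvX⟩ := hcover v hv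
    obtain ⟨Y, hXY, hY⟩ := F.exists_le_maximal hX
    refine ⟨Y, ⟨mem_filter.2 ⟨hY.1, hY⟩, hXY hvX⟩, fun Z ⟨hZ, hvZ⟩ => ?_⟩
    exact eq_of_maximal (mem_filter.1 hZ).2 hY ⟨v, mem_inter.2 ⟨hvZ, hXY hvX⟩⟩
  · obtain ⟨Y, hXY, hY⟩ := F.exists_le_maximal hX
    exact ⟨Y, mem_filter.2 ⟨hY.1, hY⟩, hXY⟩

theorem IntersectingSupermodular.exists_covers_finpartition (hq : IntersectingSupermodular q U) :
    ∃ (m : V → ℕ) (P : Finpartition U), Covers U q m ∧ (∀ X ∈ P.parts, ∑ v ∈ X, m v = q X) ∧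
      ∀ X ⊆ U, X.Nonempty → ∑ v ∈ X, m v = q X → ∃ Y ∈ P.parts, X ⊆ Y := by
  obtain ⟨m, hm⟩ := exists_minimalFor_covers U q
  let F : Finset (Finset V) := {X ∈ U.powerset | X.Nonempty ∧ ∑ v ∈ X, m v = q X}
  have mem_F {X : Finset V} : X ∈ F ↔ X ⊆ U ∧ X.Nonempty ∧ ∑ v ∈ X, m v = q X := by simp [F]
  obtain ⟨P, hPF, hFP⟩ := exists_finpartition_of_union_mem (F := F) (U := U)
    (fun X hX => (mem_F.1 hX).1) (by simp [mem_F])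
    (fun v hv => by
      obtain ⟨X, hX, hvX, ht⟩ := exists_tight_of_minimalFor_covers hm hv
      exact ⟨X, mem_F.2 ⟨hX, ⟨v, hvX⟩, ht⟩, hvX⟩)
    (fun X hX Y hY hXY => by
      rw [mem_F] at hX hY ⊢
      exact ⟨union_subset hX.1 hY.1, hX.2.1.mono subset_union_left,
        hm.1.tight_union hq hX.1 hY.1 hXY hX.2.2 hY.2.2⟩)
  exact ⟨m, P, hm.1, fun X hX => (mem_F.1 (hPF hX)).2.2,
    fun X hX hne ht => hFP X (mem_F.2 ⟨hX, hne, ht⟩)⟩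

theorem Covers.le_sum_of_mem_parts (hm : Covers U q m) {P : Finpartition U} {X : Finset V}
    (hX : X ∈ P.parts) : q X ≤ ∑ v ∈ X, m v :=
  hm X (P.subset hX) (P.nonempty_of_mem_parts hX)

theorem Covers.maxPartitionSum_le (hm : Covers U q m) : maxPartitionSum q U ≤ ∑ v ∈ U, m v :=
  Finset.sup_le fun P _ => (sum_parts_sum_eq P m) ▸ sum_le_sum fun _ => hm.le_sum_of_mem_parts

theorem Covers.sum_eq_maxPartitionSum (hm : Covers U q m) {P : Finpartition U}
    (hP : ∀ X ∈ P.parts, ∑ v ∈ X, m v = q X) : ∑ v ∈ U, m v = maxPartitionSum q U := by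
  refine le_antisymm ?_ hm.maxPartitionSum_le
  rw [← sum_parts_sum_eq P m, sum_congr rfl hP]
  exact sum_parts_le_maxPartitionSum q P

theorem IntersectingSupermodular.exists_covers_sum_eq (hq : IntersectingSupermodular q U) :
    ∃ m, Covers U q m ∧ ∑ v ∈ U, m v = maxPartitionSum q U := by
  obtain ⟨m, P, hm, hP, -⟩ := hq.exists_covers_finpartition
  exact ⟨m, hm, hm.sum_eq_maxPartitionSum hP⟩

theorem IntersectingSupermodular.exists_isGreatest (hq : IntersectingSupermodular q U) :
    ∃ P, IsGreatest {Q : Finpartition U | ∑ X ∈ Q.parts, q X = maxPartitionSum q U} P := by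
  obtain ⟨m, P, hm, hP, htight⟩ := hq.exists_covers_finpartition
  have hsum := hm.sum_eq_maxPartitionSum hP
  refine ⟨P, ?_, fun Q hQ X hX => ?_⟩
  · rw [Set.mem_ofPred_eq, ← hsum, ← sum_parts_sum_eq P m, sum_congr rfl hP]
  · have hQm : ∑ X ∈ Q.parts, q X = ∑ X ∈ Q.parts, ∑ v ∈ X, m v := by
      rw [sum_parts_sum_eq, hsum, hQ]
    exact htight X (Q.subset hX) (Q.nonempty_of_mem_parts hX)
      ((sum_eq_sum_iff_of_le fun _ => hm.le_sum_of_mem_parts).1 hQm X hX).symm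

end Supermodular

/-! ### Coloured roots -/

section Roots

open Finset

variable {K V : Type*} [DecidableEq K] [DecidableEq V] {R R' : Finset (K × V)} {X Y : Finset V}
  {i j : K} {v : V}

/-- The colours of the roots lying in `X`. All root sets `S i` are encoded by the single set `R`
of the pairs `(i, v)` with `v ∈ S i`. -/
def rootColours (R : Finset (K × V)) (X : Finset V) : Finset K :=
  (R.filter fun r => r.2 ∈ X).image Prod.fst

/-- The set of the roots of colour `i`. -/
def rootSet (R : Finset (K × V)) (i : K) : Finset V :=
  (R.filter fun r => r.1 = i).image Prod.snd

theorem mem_rootColours : i ∈ rootColours R X ↔ ∃ v ∈ X, (i, v) ∈ R := by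
  simp [rootColours, and_comm]

theorem mem_rootColours_singleton : i ∈ rootColours R {v} ↔ (i, v) ∈ R := by
  simp [mem_rootColours]

theorem mem_rootSet : v ∈ rootSet R i ↔ (i, v) ∈ R := by
  simp [rootSet]

theorem mem_rootColours_of_mem (hR : (i, v) ∈ R) (hv : v ∈ X) : i ∈ rootColours R X :=
  mem_rootColours.2 ⟨v, hv, hR⟩

theorem rootColours_mono (hR : R ⊆ R') (hX : X ⊆ Y) : rootColours R X ⊆ rootColours R' Y :=
  image_subset_image fun r hr => by
    rw [mem_filter] at hr ⊢
    exact ⟨hR hr.1, hX hr.2⟩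

theorem card_rootColours_mono (hX : X ⊆ Y) : #(rootColours R X) ≤ #(rootColours R Y) :=
  card_le_card (rootColours_mono subset_rfl hX)

theorem rootColours_union (R : Finset (K × V)) (X Y : Finset V) :
    rootColours R (X ∪ Y) = rootColours R X ∪ rootColours R Y := by
  simp only [rootColours, mem_union, filter_or, image_union]

theorem rootColours_inter_subset (R : Finset (K × V)) (X Y : Finset V) :
    rootColours R (X ∩ Y) ⊆ rootColours R X ∩ rootColours R Y :=
  subset_inter (rootColours_mono subset_rfl inter_subset_left)
    (rootColours_mono subset_rfl inter_subset_right)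

theorem rootColours_insert_of_mem (R : Finset (K × V)) (i : K) (hv : v ∈ X) :
    rootColours (insert (i, v) R) X = insert i (rootColours R X) := by
  rw [rootColours, filter_insert, if_pos hv, image_insert, rootColours]

theorem rootColours_insert_of_notMem (R : Finset (K × V)) (i : K) (hv : v ∉ X) :
    rootColours (insert (i, v) R) X = rootColours R X := by
  rw [rootColours, filter_insert, if_neg hv, rootColours]

theorem min_card_rootColours_submodular (h : ℕ) (R : Finset (K × V)) (X Y : Finset V) :
    min h #(rootColours R (X ∪ Y)) + min h #(rootColours R (X ∩ Y)) ≤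
      min h #(rootColours R X) + min h #(rootColours R Y) := by
  have := card_union_add_card_inter (rootColours R X) (rootColours R Y)
  have := card_le_card (rootColours_inter_subset R X Y)
  have := card_rootColours_mono (R := R) (subset_union_left (s₁ := X) (s₂ := Y))
  have := card_rootColours_mono (R := R) (subset_union_right (s₁ := X) (s₂ := Y))
  rw [rootColours_union] at *
  omega

theorem min_card_rootColours_submodular_strict {h : ℕ} (hX : j ∈ rootColours R X)
    (hY : j ∈ rootColours R Y) (hXY : j ∉ rootColours R (X ∩ Y))
    (hlt : #(rootColours R (X ∩ Y)) < h) :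
    min h #(rootColours R (X ∪ Y)) + min h #(rootColours R (X ∩ Y)) <
      min h #(rootColours R X) + min h #(rootColours R Y) := by
  have := card_union_add_card_inter (rootColours R X) (rootColours R Y)
  have : #(rootColours R (X ∩ Y)) < #(rootColours R X ∩ rootColours R Y) :=
    card_lt_card ⟨rootColours_inter_subset R X Y, fun h => hXY (h (mem_inter.2 ⟨hX, hY⟩))⟩
  have := card_rootColours_mono (R := R) (subset_union_left (s₁ := X) (s₂ := Y))
  have := card_rootColours_mono (R := R) (subset_union_right (s₁ := X) (s₂ := Y))
  rw [rootColours_union] at *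
  omega

theorem card_rootColours_singleton (R : Finset (K × V)) (v : V) :
    #(rootColours R {v}) = #(R.filter fun r => r.2 = v) := by
  simp only [rootColours, mem_singleton]
  refine card_image_of_injOn fun r hr r' hr' heq => Prod.ext heq ?_
  exact (mem_filter.1 hr).2.trans (mem_filter.1 hr').2.symm

theorem card_rootSet (R : Finset (K × V)) (i : K) :
    #(rootSet R i) = #(R.filter fun r => r.1 = i) :=
  card_image_of_injOn fun _ hr _ hr' heq =>
    Prod.ext ((mem_filter.1 hr).2.trans (mem_filter.1 hr').2.symm) heq

theorem sum_card_rootColours_singleton [Fintype K] {U : Finset V}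
    (hR : ∀ i, rootSet R i ⊆ U) :
    ∑ v ∈ U, #(rootColours R {v}) = ∑ i, #(rootSet R i) := by
  have hsnd : Set.MapsTo Prod.snd (R : Set (K × V)) U := fun r hr => hR r.1 (mem_rootSet.2 hr)
  simp only [card_rootColours_singleton, card_rootSet]
  rw [← card_eq_sum_card_fiberwise hsnd,
    ← card_eq_sum_card_fiberwise (f := Prod.fst) (t := univ) fun _ _ => mem_univ _]

/-- Rado's theorem for `n i` copies of the set `{i} ×ˢ U` for every colour `i`. -/
theorem exists_roots_of_submodular [Fintype K] {f : Finset (K × V) → ℤ} {U : Finset V} {n : K → ℕ}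
    (hmono : Monotone f) (hsub : ∀ R R', f (R ∪ R') + f (R ∩ R') ≤ f R + f R')
    (hn : ∀ i, n i ≤ #U) (hf : ∀ I : Finset K, (∑ i ∈ I, n i : ℕ) ≤ f (I ×ˢ U)) :
    ∃ R : Finset (K × V), (∀ i, rootSet R i ⊆ U ∧ #(rootSet R i) ≤ n i) ∧ (∑ i, n i : ℕ) ≤ f R := by
  have hne (j : Σ i, Fin (n i)) : (({j.1} : Finset K) ×ˢ U).Nonempty :=
    (singleton_nonempty _).product (card_pos.1 (j.2.pos.trans_le (hn j.1)))
  have hrado (J : Finset (Σ i, Fin (n i))) :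
      (#J : ℤ) ≤ f (J.biUnion fun j => ({j.1} : Finset K) ×ˢ U) := by
    let I : Finset K := J.image Sigma.fst
    have hJ : #J ≤ ∑ i ∈ I, n i := by
      have : J ⊆ I.sigma fun i => (univ : Finset (Fin (n i))) := fun j hj =>
        mem_sigma.2 ⟨mem_image_of_mem _ hj, mem_univ _⟩
      simpa using card_le_card this
    have hI : J.biUnion (fun j => ({j.1} : Finset K) ×ˢ U) = I ×ˢ U := by
      ext ⟨i, v⟩
      simp only [mem_biUnion, mem_product, mem_singleton, I, mem_image]
      grind
    exact hI ▸ (Nat.cast_le.2 hJ).trans (hf I)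
  obtain ⟨x, hx, hxJ⟩ := exists_transversal_of_submodular hmono hsub hne hrado
  simp only [mem_product, mem_singleton] at hx
  have mem_image {i : K} {v : V} (hv : v ∈ rootSet (univ.image x) i) :
      v ∈ univ.image fun t : Fin (n i) => (x ⟨i, t⟩).2 := by
    obtain ⟨⟨j, t⟩, -, hj⟩ := Finset.mem_image.1 (mem_rootSet.1 hv)
    obtain rfl : i = j := by simpa [hj] using (hx ⟨j, t⟩).1
    exact Finset.mem_image.2 ⟨t, mem_univ _, congrArg Prod.snd hj⟩
  refine ⟨univ.image x, fun i => ⟨fun v hv => ?_, ?_⟩, by simpa using hxJ univ⟩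
  · obtain ⟨t, -, rfl⟩ := Finset.mem_image.1 (mem_image hv)
    exact (hx ⟨i, t⟩).2
  · simpa using (card_le_card fun v => mem_image).trans card_image_le

end Roots

/-! ### Demands of partitions -/

namespace FinHypergraph

open Finset

variable {V ε : Type*} (G : FinHypergraph V ε)

theorem ends_nonempty {e : ε} (he : e ∈ G.edges) : (G.ends e).Nonempty :=
  card_pos.1 (Nat.zero_lt_two.trans_le (G.two_le_card e he))

variable [DecidableEq V]

/-- The number of hyperedges contained in `X`. -/
def innerCount (X : Finset V) : ℕ :=
  #{e ∈ G.edges | G.ends e ⊆ X}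

theorem innerCount_supermodular (X Y : Finset V) :
    G.innerCount X + G.innerCount Y ≤ G.innerCount (X ∪ Y) + G.innerCount (X ∩ Y) := by
  classical
  unfold innerCount
  rw [← card_union_add_card_inter, ← filter_or, ← filter_and]
  gcongr with e _ e
  · rintro (h | h)
    · exact h.trans subset_union_left
    · exact h.trans subset_union_right
  · exact fun h => subset_inter h.1 h.2

theorem card_edges_eq (P : Finpartition G.verts) :
    #G.edges = G.crossing P + ∑ X ∈ P.parts, G.innerCount X := by
  classical
  have part_unique {e : ε} {X Y : Finset V} (hX : X ∈ P.parts)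
      (hY : Y ∈ P.parts) (heX : (G.ends e ∩ X).Nonempty) (heY : G.ends e ⊆ Y) : X = Y := by
    obtain ⟨v, hv⟩ := heX
    rw [mem_inter] at hv
    exact P.eq_of_mem_parts hX hY hv.2 (heY hv.1)
  have hinner : ∑ X ∈ P.parts, G.innerCount X =
      #{e ∈ G.edges | ∃ X ∈ P.parts, G.ends e ⊆ X} := by
    simp only [innerCount]
    rw [← card_biUnion]
    · congr 1
      ext e
      simp only [mem_biUnion, mem_filter]
      tauto
    · refine fun X hX Y hY hXY => disjoint_left.2 fun e he he' => hXY ?_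
      rw [mem_filter] at he he'
      exact part_unique hX hY (by
        rw [inter_eq_left.2 he.2]; exact G.ends_nonempty he.1) he'.2
  rw [hinner, ← card_filter_add_card_filter_not (s := G.edges)
    fun e => ∃ X ∈ P.parts, (G.ends e ∩ X).Nonempty ∧ (G.ends e \ X).Nonempty, crossing]
  congr 2
  refine filter_congr fun e he => ⟨fun hno => ?_, ?_⟩
  · obtain ⟨v, hv⟩ := G.ends_nonempty he
    obtain ⟨X, hX, hvX⟩ := P.exists_mem (G.ends_subset e he hv)
    refine ⟨X, hX, sdiff_eq_empty_iff_subset.1 (not_nonempty_iff_eq_empty.1 fun hne => ?_)⟩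
    exact hno ⟨X, hX, ⟨v, mem_inter.2 ⟨hv, hvX⟩⟩, hne⟩
  · rintro ⟨Y, hY, heY⟩ ⟨X, hX, heX, hne⟩
    obtain rfl := part_unique hX hY heX heY
    exact sdiff_nonempty.1 hne heY

variable {K : Type*} [DecidableEq K] (h : ℕ) {R R' : Finset (K × V)}

/-- The number of hyperedges in `X` plus the number of colours that `X` lacks. The subtraction is
truncated on purpose: a set with more than `h` colours lacks none. -/
def demand (R : Finset (K × V)) (X : Finset V) : ℕ :=
  (h - #(rootColours R X)) + G.innerCount X

theorem demand_intersectingSupermodular (R : Finset (K × V)) (U : Finset V) :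
    IntersectingSupermodular (G.demand h R) U := by
  intro X _ Y _ _
  have := G.innerCount_supermodular X Y
  have := min_card_rootColours_submodular h R X Y
  unfold demand
  omega

theorem demand_anti (hR : R ⊆ R') : G.demand h R' ≤ G.demand h R := by
  intro X
  have := card_le_card (rootColours_mono hR (subset_refl X))
  simp only [demand]
  omega

theorem demand_insert_eq_iff (R : Finset (K × V)) (i : K) (v : V) (X : Finset V) :
    G.demand h (insert (i, v) R) X = G.demand h R X ↔
      (v ∈ X → i ∈ rootColours R X ∨ h ≤ #(rootColours R X)) := by
  unfold demand
  by_cases hv : v ∈ X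
  · rw [rootColours_insert_of_mem R i hv]
    by_cases hi : i ∈ rootColours R X
    · simp [hi]
    · rw [card_insert_of_notMem hi]
      simp only [hi, hv, false_or, true_imp_iff]
      omega
  · simp [rootColours_insert_of_notMem R i hv, hv]

theorem demand_le_demand_insert_add_one (R : Finset (K × V)) (i : K) (v : V) (X : Finset V) :
    G.demand h R X ≤ G.demand h (insert (i, v) R) X + if v ∈ X then 1 else 0 := by
  unfold demand
  by_cases hv : v ∈ X
  · rw [rootColours_insert_of_mem R i hv, if_pos hv]
    have := card_insert_le i (rootColours R X)
    omega
  · rw [rootColours_insert_of_notMem R i hv, if_neg hv, add_zero]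

theorem demand_insert_insert_eq {i j : K} {v w : V} {X : Finset V}
    (hi : G.demand h (insert (i, v) R) X = G.demand h R X)
    (hj : G.demand h (insert (j, w) R) X = G.demand h R X) :
    G.demand h (insert (i, v) (insert (j, w) R)) X = G.demand h R X := by
  rw [demand_insert_eq_iff] at hi
  refine ((G.demand_insert_eq_iff h _ i v X).2 fun hv => ?_).trans hj
  have hmono : rootColours R X ⊆ rootColours (insert (j, w) R) X :=
    rootColours_mono (subset_insert _ _) subset_rfl
  exact (hi hv).imp (@hmono i) fun hle => hle.trans (card_le_card hmono)

theorem maxPartitionSum_demand_anti (hR : R ⊆ R') (U : Finset V) :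
    maxPartitionSum (G.demand h R') U ≤ maxPartitionSum (G.demand h R) U :=
  Finset.sup_mono_fun fun _ _ => sum_le_sum fun X _ => G.demand_anti h hR X

theorem maxPartitionSum_demand_le_insert (R : Finset (K × V)) (a : K × V) (U : Finset V) :
    maxPartitionSum (G.demand h R) U ≤ maxPartitionSum (G.demand h (insert a R)) U + 1 := by
  refine Finset.sup_le fun P _ => ?_
  have hcount : ∑ X ∈ P.parts, (if a.2 ∈ X then 1 else 0) ≤ 1 := by
    rw [← card_filter, card_le_one]
    intro X hX Y hY
    rw [mem_filter] at hX hY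
    exact P.eq_of_mem_parts hX.1 hY.1 hX.2 hY.2
  calc ∑ X ∈ P.parts, G.demand h R X
      ≤ ∑ X ∈ P.parts, (G.demand h (insert a R) X + if a.2 ∈ X then 1 else 0) :=
        sum_le_sum fun X _ => G.demand_le_demand_insert_add_one h R a.1 a.2 X
    _ ≤ _ := by
        rw [sum_add_distrib]
        exact add_le_add (sum_parts_le_maxPartitionSum _ P) hcount

theorem demand_insert_eq_of_isGreatest {U : Finset V} {a : K × V}
    (heq : maxPartitionSum (G.demand h (insert a R)) U = maxPartitionSum (G.demand h R) U)
    {P : Finpartition U} (hP : IsGreatest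
      {Q : Finpartition U | ∑ X ∈ Q.parts, G.demand h R X = maxPartitionSum (G.demand h R) U} P)
    {X : Finset V} (hX : X ∈ P.parts) : G.demand h (insert a R) X = G.demand h R X := by
  obtain ⟨i, v⟩ := a
  obtain ⟨Q, hQ⟩ := exists_sum_parts_eq_maxPartitionSum (G.demand h (insert (i, v) R)) U
  have hle : ∀ Y ∈ Q.parts, G.demand h (insert (i, v) R) Y ≤ G.demand h R Y :=
    fun Y _ => G.demand_anti h (subset_insert _ _) Y
  have hQR : ∑ Y ∈ Q.parts, G.demand h R Y = maxPartitionSum (G.demand h R) U :=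
    (sum_parts_le_maxPartitionSum _ Q).antisymm (heq ▸ hQ ▸ sum_le_sum hle)
  have hQeq := (sum_eq_sum_iff_of_le hle).1 (by rw [hQ, hQR, heq])
  refine (G.demand_insert_eq_iff h R i v X).2 fun hv => ?_
  obtain ⟨Y, hY, hvY⟩ := Q.exists_mem (P.subset hX hv)
  obtain ⟨Z, hZ, hYZ⟩ := hP.2 hQR hY
  obtain rfl : Z = X := P.eq_of_mem_parts hZ hX (hYZ hvY) hv
  exact ((G.demand_insert_eq_iff h R i v Y).1 (hQeq Y hY) hvY).imp
    (fun hi => rootColours_mono subset_rfl hYZ hi)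
    fun hle => hle.trans (card_rootColours_mono hYZ)

theorem maxPartitionSum_demand_insert_insert (R : Finset (K × V)) (a b : K × V) (U : Finset V) :
    maxPartitionSum (G.demand h (insert a R)) U + maxPartitionSum (G.demand h (insert b R)) U ≤
      maxPartitionSum (G.demand h R) U +
        maxPartitionSum (G.demand h (insert a (insert b R))) U := by
  have := G.maxPartitionSum_demand_le_insert h (insert b R) a U
  have := G.maxPartitionSum_demand_le_insert h (insert a R) b U
  rw [insert_comm] at this
  have := G.maxPartitionSum_demand_anti h (subset_insert a R) U
  have := G.maxPartitionSum_demand_anti h (subset_insert b R) U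
  by_cases heq : maxPartitionSum (G.demand h (insert a R)) U = maxPartitionSum (G.demand h R) U ∧
      maxPartitionSum (G.demand h (insert b R)) U = maxPartitionSum (G.demand h R) U
  · obtain ⟨P, hP⟩ := (G.demand_intersectingSupermodular h R U).exists_isGreatest
    have hsame : ∑ X ∈ P.parts, G.demand h (insert a (insert b R)) X =
        ∑ X ∈ P.parts, G.demand h R X :=
      sum_congr rfl fun X hX => G.demand_insert_insert_eq h
        (G.demand_insert_eq_of_isGreatest h heq.1 hP hX)
        (G.demand_insert_eq_of_isGreatest h heq.2 hP hX)
    have := sum_parts_le_maxPartitionSum (G.demand h (insert a (insert b R))) P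
    have : ∑ X ∈ P.parts, G.demand h R X = _ := hP.1
    omega
  · omega

section Roots

variable [Fintype K] {n : K → ℕ}

theorem maxPartitionSum_demand_product_le
    (hP : ∀ P : Finpartition G.verts,
      h * #P.parts ≤ ∑ i, min (n i) #P.parts + G.crossing P) (I : Finset K) :
    maxPartitionSum (G.demand h (I ×ˢ G.verts)) G.verts ≤ #G.edges + ∑ i ∈ Iᶜ, n i := by
  refine Finset.sup_le fun P _ => ?_
  have hcolours (X : Finset V) (hX : X ∈ P.parts) : rootColours (I ×ˢ G.verts) X = I := by
    ext i
    obtain ⟨v, hv⟩ := P.nonempty_of_mem_parts hX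
    simp only [mem_rootColours, mem_product]
    exact ⟨fun ⟨_, _, hi, _⟩ => hi, fun hi => ⟨v, hv, hi, P.subset hX hv⟩⟩
  have hdemand : ∑ X ∈ P.parts, G.demand h (I ×ˢ G.verts) X =
      #P.parts * (h - #I) + ∑ X ∈ P.parts, G.innerCount X := by
    rw [← smul_eq_mul, ← sum_const, ← sum_add_distrib]
    exact sum_congr rfl fun X hX => by rw [demand, hcolours X hX]
  have hmin : ∑ i, min (n i) #P.parts ≤ #I * #P.parts + ∑ i ∈ Iᶜ, n i := by
    rw [← sum_add_sum_compl I, ← smul_eq_mul]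
    gcongr
    · exact sum_le_card_nsmul _ _ _ fun i _ => min_le_right _ _
    · exact min_le_left _ _
  have := hP P
  rw [hdemand, G.card_edges_eq P, mul_comm, Nat.sub_mul]
  omega

theorem exists_roots_maxPartitionSum_demand_le (hn : ∀ i, n i ≤ #G.verts)
    (hP : ∀ P : Finpartition G.verts,
      h * #P.parts ≤ ∑ i, min (n i) #P.parts + G.crossing P) :
    ∃ R : Finset (K × V), (∀ i, rootSet R i ⊆ G.verts ∧ #(rootSet R i) ≤ n i) ∧
      maxPartitionSum (G.demand h R) G.verts ≤ #G.edges := by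
  let f : Finset (K × V) → ℤ :=
    fun R => ∑ i, (n i : ℤ) + #G.edges - maxPartitionSum (G.demand h R) G.verts
  have hmono : Monotone f := fun R R' hR => by
    have := G.maxPartitionSum_demand_anti h hR G.verts
    simp only [f]
    omega
  have hsub := submodular_of_insert (f := f) fun R a b => by
    have := G.maxPartitionSum_demand_insert_insert h R a b G.verts
    simp only [f]
    omega
  have hf (I : Finset K) : (∑ i ∈ I, n i : ℕ) ≤ f (I ×ˢ G.verts) := by
    have := G.maxPartitionSum_demand_product_le h hP I
    have := sum_add_sum_compl I n
    simp only [f, ← Nat.cast_sum]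
    omega
  obtain ⟨R, hR, hle⟩ := exists_roots_of_submodular hmono hsub hn hf
  simp only [f, ← Nat.cast_sum] at hle
  exact ⟨R, hR, by omega⟩

end Roots

end FinHypergraph

/-! ### Orientations -/

open Finset in
/-- **Hall's theorem** with capacities. -/
theorem exists_assignment_of_card_le_sum {ι V : Type*} [Fintype ι] [DecidableEq V]
    {A : ι → Finset V} {m : V → ℕ}
    (hA : ∀ J : Finset ι, #J ≤ ∑ v ∈ J.biUnion A, m v) :
    ∃ f : ι → V, (∀ i, f i ∈ A i) ∧ ∀ v, #{i | f i = v} ≤ m v := by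
  let slots : ι → Finset (Σ v, Fin (m v)) := fun i => (A i).sigma fun _ => univ
  have hhall (J : Finset ι) : #J ≤ #(J.biUnion slots) := by
    have : J.biUnion slots = (J.biUnion A).sigma fun _ => univ := by
      ext ⟨v, t⟩
      simp [slots]
    simpa [this] using hA J
  obtain ⟨g, hg, hgA⟩ := (all_card_le_biUnion_card_iff_exists_injective slots).1 hhall
  refine ⟨fun i => (g i).1, fun i => (mem_sigma.1 (hgA i)).1, fun v => ?_⟩
  calc #{i | (g i).1 = v} ≤ #(({v} : Finset V).sigma fun v => (univ : Finset (Fin (m v)))) := by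
        refine card_le_card_of_injOn g (fun i hi => ?_) hg.injOn
        simpa using hi
    _ = m v := by simp

namespace FinDypergraph

open Finset

variable {V ε : Type*} [DecidableEq V]

/-- The hyperarcs that enter `X`: those with head in `X` and a tail outside `X`. -/
def enter (D : FinDypergraph V ε) (X : Finset V) : Finset ε :=
  {a ∈ D.arcs | D.head a ∈ X ∧ ¬D.tails a ⊆ X}

theorem mem_enter {D : FinDypergraph V ε} {X : Finset V} {a : ε} :
    a ∈ D.enter X ↔ a ∈ D.arcs ∧ D.head a ∈ X ∧ ¬D.tails a ⊆ X :=
  mem_filter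

/-- The cut condition of the packing theorem: every non-empty set of vertices is entered by as many
hyperarcs as it lacks colours of roots. -/
def CutCondition {K : Type*} [DecidableEq K] (D : FinDypergraph V ε) (h : ℕ)
    (R : Finset (K × V)) : Prop :=
  ∀ X ⊆ D.verts, X.Nonempty → h ≤ #(D.enter X) + #(rootColours R X)

end FinDypergraph

namespace FinHypergraph

open Finset

variable {V ε : Type*} [DecidableEq V] (G : FinHypergraph V ε) {m : V → ℕ}

/-- The orientation of `G` in which `head e` is the head of the hyperedge `e`. -/
def orient (head : ε → V) (hhead : ∀ e ∈ G.edges, head e ∈ G.ends e) : FinDypergraph V ε where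
  verts := G.verts
  arcs := G.edges
  head := head
  tails e := (G.ends e).erase (head e)
  head_mem e he := G.ends_subset e he (hhead e he)
  tails_subset e he := (erase_subset _ _).trans (G.ends_subset e he)
  tails_nonempty e he :=
    (one_lt_card_iff_nontrivial.1 (Nat.lt_of_succ_le (G.two_le_card e he))).erase_nonempty
  head_notMem_tails _ _ := notMem_erase _ _

theorem isOrientation_orient (head : ε → V) (hhead : ∀ e ∈ G.edges, head e ∈ G.ends e) :
    G.IsOrientation (G.orient head hhead) :=
  ⟨rfl, rfl, fun e he => ⟨hhead e he, rfl⟩⟩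

theorem exists_heads_card_le [Nonempty V] (hm : Covers G.verts G.innerCount m) :
    ∃ head : ε → V, (∀ e ∈ G.edges, head e ∈ G.ends e) ∧
      ∀ v, #{e ∈ G.edges | head e = v} ≤ m v := by
  classical
  have hhall (J : Finset G.edges) : #J ≤ ∑ v ∈ J.biUnion fun e => G.ends e, m v := by
    obtain rfl | ⟨e, he⟩ := J.eq_empty_or_nonempty
    · simp
    have hJ : #J ≤ G.innerCount (J.biUnion fun e => G.ends e) := by
      rw [← card_map (Function.Embedding.subtype _)]
      refine card_le_card fun e he => ?_
      obtain ⟨e', he', rfl⟩ := mem_map.1 he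
      exact mem_filter.2 ⟨e'.2, subset_biUnion_of_mem (fun e : G.edges => G.ends e) he'⟩
    exact hJ.trans (hm _ (biUnion_subset.2 fun e _ => G.ends_subset e e.2)
      ((G.ends_nonempty e.2).mono (subset_biUnion_of_mem (fun e : G.edges => G.ends e) he)))
  obtain ⟨f, hf, hfm⟩ := exists_assignment_of_card_le_sum hhall
  let head : ε → V := Function.extend Subtype.val f fun _ => Classical.arbitrary V
  have hhead (e : G.edges) : head e = f e := Subtype.val_injective.extend_apply f _ e
  refine ⟨head, fun e he => hhead ⟨e, he⟩ ▸ hf ⟨e, he⟩, fun v => (hfm v).trans' ?_⟩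
  rw [← card_map (Function.Embedding.subtype _)]
  refine card_le_card fun e he => ?_
  rw [mem_filter] at he
  exact mem_map.2 ⟨⟨e, he.1⟩, by simpa [← hhead] using he.2, rfl⟩

theorem card_filter_head_mem_le {head : ε → V} (hhead : ∀ e ∈ G.edges, head e ∈ G.ends e)
    (X : Finset V) :
    #{e ∈ G.edges | head e ∈ X} ≤ #((G.orient head hhead).enter X) + G.innerCount X := by
  classical
  refine (card_le_card fun e he => ?_).trans (card_union_le _ _)
  rw [mem_filter] at he
  rw [mem_union, FinDypergraph.mem_enter, mem_filter, or_iff_not_imp_right]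
  refine fun hno => ⟨he.1, he.2, fun htails => hno ⟨he.1, ?_⟩⟩
  rw [← insert_erase (hhead e he.1)]
  exact insert_subset he.2 htails

variable {K : Type*} [DecidableEq K] {h : ℕ} {R : Finset (K × V)}

theorem exists_isOrientation_cutCondition [Nonempty V]
    (hR : maxPartitionSum (G.demand h R) G.verts ≤ #G.edges) :
    ∃ D, G.IsOrientation D ∧ D.CutCondition h R := by
  obtain ⟨m, hm, hsum⟩ := (G.demand_intersectingSupermodular h R G.verts).exists_covers_sum_eq
  obtain ⟨head, hhead, hdeg⟩ := G.exists_heads_card_le (m := m)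
    fun X hX hne => (Nat.le_add_left _ _).trans (hm X hX hne)
  refine ⟨G.orient head hhead, G.isOrientation_orient head hhead, fun X hX hne => ?_⟩
  replace hX : X ⊆ G.verts := hX
  have hhead_mem (e : ε) (he : e ∈ G.edges) : head e ∈ G.verts := G.ends_subset e he (hhead e he)
  have houtside : #{e ∈ G.edges | head e ∉ X} ≤ ∑ v ∈ G.verts \ X, m v := by
    rw [card_eq_sum_card_fiberwise (f := head) (t := G.verts \ X) fun e he => by
      rw [mem_coe, mem_filter] at he
      exact mem_sdiff.2 ⟨hhead_mem e he.1, he.2⟩]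
    exact sum_le_sum fun v _ =>
      (card_le_card (filter_subset_filter _ (filter_subset _ _))).trans (hdeg v)
  have hdemand : h - #(rootColours R X) + G.innerCount X ≤ ∑ v ∈ X, m v := hm X hX hne
  have := sum_sdiff (f := m) hX
  have := card_filter_add_card_filter_not (s := G.edges) fun e => head e ∈ X
  have := G.card_filter_head_mem_le hhead X
  omega

end FinHypergraph

/-! ### Balancing the roots -/

section MoveRoot

open Finset

variable {K V : Type*} [DecidableEq K] [DecidableEq V] {R : Finset (K × V)} {U X : Finset V}
  {i j : K} {u v w : V} {h : ℕ}

/-- The roots obtained from `R` by moving the root of colour `i` from the vertex `v` to the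
vertex `u`. -/
def moveRoot (R : Finset (K × V)) (i : K) (v u : V) : Finset (K × V) :=
  insert (i, u) (R.erase (i, v))

theorem mem_moveRoot :
    (j, w) ∈ moveRoot R i v u ↔ (j = i ∧ w = u) ∨ (¬(j = i ∧ w = v) ∧ (j, w) ∈ R) := by
  simp [moveRoot]

theorem card_rootSet_moveRoot (hv : (i, v) ∈ R) (hu : (i, u) ∉ R) (j : K) :
    #(rootSet (moveRoot R i v u) j) = #(rootSet R j) := by
  obtain rfl | hj := eq_or_ne j i
  · have : rootSet (moveRoot R j v u) j = insert u ((rootSet R j).erase v) := by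
      ext w
      simp [mem_rootSet, mem_moveRoot]
    rw [this, card_insert_of_notMem (by simp [mem_rootSet, hu]),
      card_erase_add_one (mem_rootSet.2 hv)]
  · congr 1
    ext w
    simp [mem_rootSet, mem_moveRoot, hj]

theorem rootSet_moveRoot_subset (hR : rootSet R j ⊆ U) (hu : u ∈ U) :
    rootSet (moveRoot R i v u) j ⊆ U := fun w hw => by
  obtain ⟨-, rfl⟩ | ⟨-, hw⟩ := mem_moveRoot.1 (mem_rootSet.1 hw)
  · exact hu
  · exact hR (mem_rootSet.2 hw)

theorem rootColours_subset_rootColours_moveRoot (hv : v ∉ X) :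
    rootColours R X ⊆ rootColours (moveRoot R i v u) X := fun j hj => by
  obtain ⟨w, hw, hjw⟩ := mem_rootColours.1 hj
  exact mem_rootColours_of_mem (mem_moveRoot.2 (.inr ⟨fun h => hv (h.2 ▸ hw), hjw⟩)) hw

theorem rootColours_moveRoot_singleton_source (huv : u ≠ v) :
    rootColours (moveRoot R i v u) {v} = (rootColours R {v}).erase i := by
  ext j
  simp [mem_rootColours_singleton, mem_moveRoot, huv.symm]

theorem rootColours_moveRoot_singleton_target_subset :
    rootColours (moveRoot R i v u) {u} ⊆ insert i (rootColours R {u}) := fun j => by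
  simp only [mem_rootColours_singleton, mem_moveRoot, mem_insert]
  tauto

theorem rootColours_moveRoot_singleton_subset (hw : w ≠ u) :
    rootColours (moveRoot R i v u) {w} ⊆ rootColours R {w} := fun j => by
  simp only [mem_rootColours_singleton, mem_moveRoot]
  tauto

theorem sum_excess_moveRoot_lt (hvU : v ∈ U) (hv : (i, v) ∈ R) (hu : (i, u) ∉ R)
    (hvh : h < #(rootColours R {v})) (huh : #(rootColours R {u}) < h) :
    ∑ w ∈ U, (#(rootColours (moveRoot R i v u) {w}) - h) < ∑ w ∈ U, (#(rootColours R {w}) - h) := by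
  have huv : u ≠ v := fun h => hu (h ▸ hv)
  refine sum_lt_sum (fun w _ => ?_) ⟨v, hvU, ?_⟩
  · obtain rfl | hw := eq_or_ne w u
    · have := (card_le_card (rootColours_moveRoot_singleton_target_subset (R := R) (i := i) (v := v)
        (u := w))).trans (card_insert_le _ _)
      omega
    · exact Nat.sub_le_sub_right (card_le_card (rootColours_moveRoot_singleton_subset hw)) h
  · rw [rootColours_moveRoot_singleton_source huv,
      card_erase_of_mem (mem_rootColours_singleton.2 hv)]
    omega

end MoveRoot

namespace FinDypergraph

open Finset

variable {K V ε : Type*} [DecidableEq K] [DecidableEq V] {D : FinDypergraph V ε} {h : ℕ}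
  {R R' : Finset (K × V)}

theorem CutCondition.mono (hD : D.CutCondition h R) (hR : R ⊆ R') : D.CutCondition h R' :=
  fun X hX hne => (hD X hX hne).trans
    (Nat.add_le_add_left (card_le_card (rootColours_mono hR subset_rfl)) _)

theorem CutCondition.cutCondition_moveRoot {i : K} {u v : V} (hD : D.CutCondition h R) (huv : u ≠ v)
    (hvh : h < #(rootColours R {v})) : D.CutCondition h (moveRoot R i v u) := by
  intro X hX hne
  by_cases hvX : v ∈ X
  · have h₁ : #(rootColours (moveRoot R i v u) {v}) ≤
        #(rootColours (moveRoot R i v u) X) :=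
      card_rootColours_mono (singleton_subset_iff.2 hvX)
    rw [rootColours_moveRoot_singleton_source huv] at h₁
    have h₂ : #(rootColours R {v}) - 1 ≤ #((rootColours R {v}).erase i) := pred_card_le_card_erase
    omega
  · exact (hD X hX hne).trans
      (Nat.add_le_add_left (card_le_card (rootColours_subset_rootColours_moveRoot hvX)) _)

variable [Fintype K]

theorem CutCondition.exists_balanced (hD : D.CutCondition h R) (hR : ∀ i, rootSet R i ⊆ D.verts)
    (hsum : ∑ i, #(rootSet R i) ≤ h * #D.verts) :
    ∃ R' : Finset (K × V), (∀ i, rootSet R' i ⊆ D.verts ∧ #(rootSet R' i) = #(rootSet R i)) ∧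
      D.CutCondition h R' ∧ ∀ v ∈ D.verts, #(rootColours R' {v}) ≤ h := by
  induction hn : ∑ v ∈ D.verts, (#(rootColours R {v}) - h) using Nat.strong_induction_on
    generalizing R with
  | _ n ih =>
    by_cases hle : ∀ v ∈ D.verts, #(rootColours R {v}) ≤ h
    · exact ⟨R, fun i => ⟨hR i, rfl⟩, hD, hle⟩
    push Not at hle
    obtain ⟨v, hv, hvh⟩ := hle
    obtain ⟨u, hu, huh⟩ : ∃ u ∈ D.verts, #(rootColours R {u}) < h := by
      by_contra! hge
      have : ∑ _w ∈ D.verts, h < ∑ w ∈ D.verts, #(rootColours R {w}) :=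
        sum_lt_sum hge ⟨v, hv, hvh⟩
      rw [sum_card_rootColours_singleton hR, sum_const, smul_eq_mul, mul_comm] at this
      omega
    obtain ⟨i, hiv, hiu⟩ := exists_mem_notMem_of_card_lt_card (huh.trans hvh)
    rw [mem_rootColours_singleton] at hiv hiu
    have hcard := card_rootSet_moveRoot hiv hiu
    obtain ⟨R', hR', hD', hle'⟩ := ih _ (hn ▸ sum_excess_moveRoot_lt hv hiv hiu hvh huh)
      (hD.cutCondition_moveRoot (by rintro rfl; exact hiu hiv) hvh)
      (fun j => rootSet_moveRoot_subset (hR j) hu) (by simpa only [hcard] using hsum) rfl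
    exact ⟨R', fun j => ⟨(hR' j).1, (hR' j).2.trans (hcard j)⟩, hD', hle'⟩

theorem CutCondition.exists_balanced_card_eq {n : K → ℕ} (hD : D.CutCondition h R)
    (hR : ∀ i, rootSet R i ⊆ D.verts ∧ #(rootSet R i) ≤ n i) (hn : ∀ i, n i ≤ #D.verts)
    (hsum : ∑ i, n i ≤ h * #D.verts) :
    ∃ R' : Finset (K × V), (∀ i, rootSet R' i ⊆ D.verts ∧ #(rootSet R' i) = n i) ∧
      D.CutCondition h R' ∧ ∀ v ∈ D.verts, #(rootColours R' {v}) ≤ h := by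
  choose S hRS hSU hSn using fun i => exists_subsuperset_card_eq (hR i).1 (hR i).2 (hn i)
  let R₁ : Finset (K × V) := univ.biUnion fun i => {i} ×ˢ S i
  have hR₁ (i : K) : rootSet R₁ i = S i := by
    ext v
    simp [mem_rootSet, R₁]
  have hRR₁ : R ⊆ R₁ := fun ⟨i, v⟩ hiv =>
    mem_rootSet.1 (hR₁ i ▸ hRS i (mem_rootSet.2 hiv))
  obtain ⟨R', hR', hD', hle⟩ := (hD.mono hRR₁).exists_balanced
    (fun i => (hR₁ i).trans_subset (hSU i)) (by simpa only [hR₁, hSn] using hsum)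
  exact ⟨R', fun i => ⟨(hR' i).1, by rw [(hR' i).2, hR₁, hSn]⟩, hD', hle⟩

end FinDypergraph

/-! ### Branchings and hyperbranchings -/

section Branching

open Finset

variable {V ε : Type*} {S S' U : Finset V} {A A' : Finset ε} {tail tail' head : ε → V} {v : V}
  {p p' : List ε}

theorem IsDipathTo.unique (hS : ∀ a ∈ A, head a ∉ S) (hinj : Set.InjOn head A)
    (hp : IsDipathTo S A tail head v p) (hp' : IsDipathTo S A tail head v p') : p = p' := by
  induction p generalizing v p' with
  | nil =>
    cases p' with
    | nil => rfl
    | cons b p' => exact absurd (hp'.2.1 ▸ hp) (hS b hp'.1)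
  | cons a p ih =>
    cases p' with
    | nil => exact absurd (hp.2.1 ▸ hp') (hS a hp.1)
    | cons b p' =>
      obtain rfl : a = b := hinj hp.1 hp'.1 (hp.2.1.trans hp'.2.1.symm)
      rw [ih hp.2.2 hp'.2.2]

theorem IsDipathTo.exists_isDipathTo (hp : IsDipathTo S' A' tail' head v p)
    (hA : ∀ b ∈ A', b ∈ A ∧ tail b = tail' b)
    (hS : ∀ s ∈ S', ∃ p, IsDipathTo S A tail head s p) : ∃ p, IsDipathTo S A tail head v p := by
  induction p generalizing v with
  | nil => exact hS v hp
  | cons b p ih =>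
    obtain ⟨hb, hv, hp⟩ := hp
    obtain ⟨p', hp'⟩ := ih hp
    exact ⟨b :: p', (hA b hb).1, hv, (hA b hb).2.symm ▸ hp'⟩

theorem isBranching_iff :
    IsBranching U A tail head S ↔ S ⊆ U ∧ (∀ a ∈ A, tail a ∈ U ∧ head a ∈ U) ∧
      (∀ a ∈ A, head a ∉ S) ∧ Set.InjOn head A ∧ ∀ v ∈ U, ∃ p, IsDipathTo S A tail head v p := by
  refine and_congr_right fun _ => and_congr_right fun hends => ⟨fun h => ⟨fun a ha haS => ?_,
    fun a ha b hb hab => ?_, fun v hv => (h v hv).exists⟩, fun ⟨hS, hinj, hpath⟩ v hv => ?_⟩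
  · obtain ⟨p, hp, -⟩ := h _ (hends a ha).1
    have : [] = a :: p := (h _ (hends a ha).2).unique haS ⟨ha, rfl, hp⟩
    contradiction
  · obtain ⟨p, hp, -⟩ := h _ (hends a ha).1
    obtain ⟨q, hq, -⟩ := h _ (hends b hb).1
    exact (List.cons.inj ((h _ (hends a ha).2).unique (y₁ := a :: p) (y₂ := b :: q)
      ⟨ha, rfl, hp⟩ ⟨hb, hab.symm, hq⟩)).1
  · exact existsUnique_of_exists_of_unique (hpath v hv) fun _ _ hp hp' => hp.unique hS hinj hp'

theorem IsBranching.insert_arc [DecidableEq V] [DecidableEq ε] {a : ε} {u : V}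
    (hB : IsBranching U A tail head (insert (head a) S)) (haA : a ∉ A) (haS : head a ∉ S)
    (hu : u ∈ S) : IsBranching U (insert a A) (Function.update tail a u) head S := by
  obtain ⟨hU, hends, hheads, hinj, hpath⟩ := isBranching_iff.1 hB
  rw [insert_subset_iff] at hU
  simp only [mem_insert, not_or] at hheads
  have htail (b : ε) (hb : b ∈ A) : Function.update tail a u b = tail b :=
    Function.update_of_ne (ne_of_mem_of_not_mem hb haA) _ _
  refine isBranching_iff.2 ⟨hU.2, forall_mem_insert _ _ _ |>.2 ⟨?_, fun b hb => ?_⟩,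
    forall_mem_insert _ _ _ |>.2 ⟨haS, fun b hb => (hheads b hb).2⟩, ?_, fun v hv => ?_⟩
  · exact ⟨by simpa using hU.2 hu, hU.1⟩
  · simpa only [htail b hb] using hends b hb
  · rw [coe_insert, Set.injOn_insert (mod_cast haA)]
    exact ⟨hinj, fun ⟨b, hb, hba⟩ => (hheads b hb).1 hba⟩
  · obtain ⟨p, hp⟩ := hpath v hv
    refine hp.exists_isDipathTo (fun b hb => ⟨mem_insert_of_mem hb, htail b hb⟩)
      (forall_mem_insert _ _ _ |>.2 ⟨⟨[a], mem_insert_self a A, rfl, ?_⟩, fun s hs => ⟨[], hs⟩⟩)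
    simpa [IsDipathTo] using hu

end Branching

namespace FinDypergraph

open Finset

variable {V ε : Type*} [DecidableEq V] {D : FinDypergraph V ε} {S : Finset V}

/-- The directed subhypergraph of `D` on all vertices with set of hyperarcs `A`. -/
def restrictArcs (D : FinDypergraph V ε) (A : Finset ε) (hA : A ⊆ D.arcs) :
    FinDypergraph V ε where
  verts := D.verts
  arcs := A
  head := D.head
  tails := D.tails
  head_mem a ha := D.head_mem a (hA ha)
  tails_subset a ha := D.tails_subset a (hA ha)
  tails_nonempty a ha := D.tails_nonempty a (hA ha)
  head_notMem_tails a ha := D.head_notMem_tails a (hA ha)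

theorem isHyperbranching_of_arcs_eq_empty (hD : D.arcs = ∅) (hS : S ⊆ D.verts) :
    D.IsHyperbranching S := by
  have hcore : D.core S = S := by rw [core, hD, image_empty, empty_union]
  refine ⟨hS, D.head, by simp [hD], isBranching_iff.2 ⟨hcore.symm.subset, ?_⟩⟩
  simp only [hD, notMem_empty, false_imp_iff, implies_true, coe_empty, Set.injOn_empty, true_and]
  exact fun v hv => ⟨[], hcore.subset hv⟩

variable [DecidableEq ε] {A : Finset ε} {hA : A ⊆ D.arcs} {a : ε} {u : V}

theorem core_restrictArcs_insert (haA : insert a A ⊆ D.arcs) :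
    (D.restrictArcs (insert a A) haA).core S =
      (D.restrictArcs A hA).core (insert (D.head a) S) := by
  simp only [core, restrictArcs, image_insert, insert_union, union_insert]

theorem IsHyperbranching.insert_arc
    (hB : (D.restrictArcs A hA).IsHyperbranching (insert (D.head a) S)) (haD : a ∈ D.arcs)
    (haA : a ∉ A) (haS : D.head a ∉ S) (hut : u ∈ D.tails a) (hu : u ∈ S) :
    (D.restrictArcs (insert a A) (insert_subset haD hA)).IsHyperbranching S := by
  obtain ⟨hS, tail, htail, hB⟩ := hB
  refine ⟨(subset_insert _ _).trans hS, Function.update tail a u,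
    forall_mem_insert _ _ _ |>.2 ⟨?_, fun b hb => ?_⟩, ?_⟩
  · rw [Function.update_self]
    exact hut
  · rw [Function.update_of_ne (ne_of_mem_of_not_mem hb haA)]
    exact htail b hb
  · rw [core_restrictArcs_insert (hA := hA)]
    exact hB.insert_arc haA haS hu

end FinDypergraph

/-! ### Packing hyperbranchings -/

section InsertRoot

open Finset

variable {K V : Type*} [DecidableEq K] [DecidableEq V]

theorem rootSet_insert_self (R : Finset (K × V)) (i : K) (v : V) :
    rootSet (insert (i, v) R) i = insert v (rootSet R i) := by
  ext w
  simp [mem_rootSet]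

theorem rootSet_insert_of_ne (R : Finset (K × V)) {i j : K} (hij : i ≠ j) (v : V) :
    rootSet (insert (j, v) R) i = rootSet R i := by
  ext w
  simp [mem_rootSet, hij]

end InsertRoot

namespace FinDypergraph

open Finset

variable {K V ε : Type*} [DecidableEq K] [DecidableEq V] {D : FinDypergraph V ε} {h : ℕ}
  {R : Finset (K × V)} {X Z : Finset V} {a : ε} {j : K} {v : V}

theorem card_enter_submodular (D : FinDypergraph V ε) (X Y : Finset V) :
    #(D.enter (X ∪ Y)) + #(D.enter (X ∩ Y)) ≤ #(D.enter X) + #(D.enter Y) := by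
  simp only [enter, card_filter, ← sum_add_distrib]
  refine sum_le_sum fun a _ => ?_
  have hX : D.tails a ⊆ X → D.tails a ⊆ X ∪ Y := fun h => h.trans subset_union_left
  have hY : D.tails a ⊆ Y → D.tails a ⊆ X ∪ Y := fun h => h.trans subset_union_right
  simp only [mem_union, mem_inter, subset_inter_iff]
  split_ifs <;> first | omega | tauto

theorem CutCondition.le_card_enter_add_min (hD : D.CutCondition h R) (hX : X ⊆ D.verts)
    (hne : X.Nonempty) : h ≤ #(D.enter X) + min h #(rootColours R X) := by
  have := hD X hX hne
  omega

/-- A set of vertices is critical if it satisfies the cut condition with equality, colours of roots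
being counted up to `h`, and one of its vertices carries fewer colours than the whole set. Replacing
a hyperarc inside a critical set by a new root spreads a missing colour to its head. -/
def IsCritical (D : FinDypergraph V ε) (h : ℕ) (R : Finset (K × V)) (X : Finset V) : Prop :=
  X ⊆ D.verts ∧ #(D.enter X) + min h #(rootColours R X) = h ∧
    ∃ v ∈ X, #(rootColours R {v}) < min h #(rootColours R X)

theorem CutCondition.isCritical_verts (hD : D.CutCondition h R) (hv : v ∈ D.verts)
    (hvh : #(rootColours R {v}) < h) : D.IsCritical h R D.verts := by
  have henter : #(D.enter D.verts) = 0 :=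
    card_eq_zero.2 (filter_false_of_mem fun a ha h => h.2 (D.tails_subset a ha))
  have := hD D.verts subset_rfl ⟨v, hv⟩
  exact ⟨subset_rfl, by omega, v, hv, by omega⟩

theorem IsCritical.exists_arc (hX : D.IsCritical h R X) (hD : D.CutCondition h R) :
    ∃ a ∈ D.arcs, D.head a ∈ X ∧ D.tails a ⊆ X ∧ #(rootColours R {D.head a}) < h ∧
      ∃ u ∈ D.tails a, ∃ j, (j, u) ∈ R ∧ (j, D.head a) ∉ R := by
  obtain ⟨hXD, htight, v, hvX, hvlt⟩ := hX
  let Y : Finset V := {w ∈ X | rootColours R {w} ⊆ rootColours R {v}}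
  have hYX : Y ⊆ X := filter_subset _ _
  have hvY : v ∈ Y := mem_filter.2 ⟨hvX, subset_rfl⟩
  have hYcolours : #(rootColours R Y) ≤ #(rootColours R {v}) := by
    refine card_le_card fun i hi => ?_
    obtain ⟨w, hw, hiw⟩ := mem_rootColours.1 hi
    exact (mem_filter.1 hw).2 (mem_rootColours_singleton.2 hiw)
  have henter : #(D.enter X) < #(D.enter Y) := by
    have := hD Y (hYX.trans hXD) ⟨v, hvY⟩
    omega
  obtain ⟨a, haY, haX⟩ := exists_mem_notMem_of_card_lt_card henter
  obtain ⟨haD, hheadY, htailsY⟩ := mem_enter.1 haY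
  have htailsX : D.tails a ⊆ X :=
    not_not.1 fun htails => haX (mem_enter.2 ⟨haD, hYX hheadY, htails⟩)
  obtain ⟨u, hu, huY⟩ := not_subset.1 htailsY
  obtain ⟨j, hju, hjv⟩ := not_subset.1 fun hsub => huY (mem_filter.2 ⟨htailsX hu, hsub⟩)
  have hhead : rootColours R {D.head a} ⊆ rootColours R {v} := (mem_filter.1 hheadY).2
  refine ⟨a, haD, hYX hheadY, htailsX, ?_, u, hu, j, mem_rootColours_singleton.1 hju,
    fun hja => hjv (hhead (mem_rootColours_singleton.2 hja))⟩
  exact (card_le_card hhead).trans_lt (hvlt.trans_le (min_le_left _ _))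

theorem CutCondition.inter_tight (hD : D.CutCondition h R) (hX : X ⊆ D.verts) (hZ : Z ⊆ D.verts)
    (hXZ : (X ∩ Z).Nonempty) (hXt : #(D.enter X) + min h #(rootColours R X) = h)
    (hZt : #(D.enter Z) + min h #(rootColours R Z) = h) :
    #(D.enter (X ∩ Z)) + min h #(rootColours R (X ∩ Z)) = h ∧
      min h #(rootColours R (X ∪ Z)) + min h #(rootColours R (X ∩ Z)) =
        min h #(rootColours R X) + min h #(rootColours R Z) := by
  have := card_enter_submodular D X Z
  have := min_card_rootColours_submodular h R X Z
  have := hD.le_card_enter_add_min (inter_subset_left.trans hX) hXZ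
  have := hD.le_card_enter_add_min (union_subset hX hZ)
    (hXZ.mono (inter_subset_left.trans subset_union_left))
  omega

theorem CutCondition.lt_of_minimal_isCritical (hD : D.CutCondition h R)
    (hX : Minimal (D.IsCritical h R) X) (haX : D.head a ∈ X) (htails : D.tails a ⊆ X)
    (hah : #(rootColours R {D.head a}) < h) (hja : (j, D.head a) ∉ R) (hjX : j ∈ rootColours R X)
    (hZ : Z ⊆ D.verts) (haZ : a ∈ D.enter Z) (hjZ : j ∈ rootColours R Z) :
    h < #(D.enter Z) + #(rootColours R Z) := by
  obtain ⟨hXD, hXt, -⟩ := hX.prop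
  obtain ⟨-, hheadZ, htailsZ⟩ := mem_enter.1 haZ
  have hhead : D.head a ∈ X ∩ Z := mem_inter.2 ⟨haX, hheadZ⟩
  by_contra! hle
  have := hD Z hZ ⟨_, hheadZ⟩
  obtain ⟨htight, hmodular⟩ := hD.inter_tight hXD hZ ⟨_, hhead⟩ hXt (by omega)
  have hnot : ¬D.IsCritical h R (X ∩ Z) := fun hc =>
    htailsZ (htails.trans ((hX.le_of_le hc inter_subset_left).trans inter_subset_right))
  have hcard : #(rootColours R (X ∩ Z)) ≤ #(rootColours R {D.head a}) := by
    by_contra! hlt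
    exact hnot ⟨inter_subset_left.trans hXD, htight, D.head a, hhead, lt_min hah hlt⟩
  have hcolours : rootColours R {D.head a} = rootColours R (X ∩ Z) :=
    eq_of_subset_of_card_le (rootColours_mono subset_rfl (singleton_subset_iff.2 hhead)) hcard
  refine (min_card_rootColours_submodular_strict hjX hjZ ?_ (hcard.trans_lt hah)).ne hmodular
  rwa [← hcolours, mem_rootColours_singleton]

variable [DecidableEq ε]

theorem enter_restrictArcs_erase (D : FinDypergraph V ε) (a : ε) (X : Finset V) :
    (D.restrictArcs (D.arcs.erase a) (erase_subset a D.arcs)).enter X = (D.enter X).erase a :=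
  filter_erase ..

theorem CutCondition.exists_arc_to_root (hD : D.CutCondition h R) (hv : v ∈ D.verts)
    (hvh : #(rootColours R {v}) < h) :
    ∃ a ∈ D.arcs, #(rootColours R {D.head a}) < h ∧
      ∃ u ∈ D.tails a, ∃ j, (j, u) ∈ R ∧ (j, D.head a) ∉ R ∧
        (D.restrictArcs (D.arcs.erase a) (erase_subset a D.arcs)).CutCondition h
          (insert (j, D.head a) R) := by
  obtain ⟨X, hX⟩ := exists_minimal_of_wellFoundedLT _ ⟨_, hD.isCritical_verts hv hvh⟩
  obtain ⟨a, haD, haX, htails, hah, u, hu, j, hju, hja⟩ := hX.prop.exists_arc hD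
  refine ⟨a, haD, hah, u, hu, j, hju, hja, fun Z hZ hne => ?_⟩
  replace hZ : Z ⊆ D.verts := hZ
  have hcut := hD Z hZ hne
  have hmono := card_le_card (rootColours_mono (subset_insert (j, D.head a) R) (subset_refl Z))
  rw [enter_restrictArcs_erase]
  by_cases haZ : a ∈ D.enter Z
  · rw [card_erase_of_mem haZ]
    by_cases hjZ : j ∈ rootColours R Z
    · have := hD.lt_of_minimal_isCritical hX haX htails hah hja
        (mem_rootColours_of_mem hju (htails hu)) hZ haZ hjZ
      omega
    · rw [rootColours_insert_of_mem R j (mem_enter.1 haZ).2.1, card_insert_of_notMem hjZ]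
      omega
  · rw [erase_eq_of_notMem haZ]
    omega

end FinDypergraph

namespace FinDypergraph

open Finset

variable {K V ε : Type*} [DecidableEq K] [DecidableEq V] [Fintype K] {h : ℕ}

/-- Pairwise arc-disjoint hyperbranchings in `D`, one of each colour `i` with root set `rootSet R i`
and set of hyperarcs `A i`, such that every vertex lies in exactly `h` cores. -/
structure IsArcPacking (D : FinDypergraph V ε) (h : ℕ) (R : Finset (K × V)) (A : K → Finset ε)
    (hA : ∀ i, A i ⊆ D.arcs) : Prop where
  disjoint : ∀ i j, i ≠ j → Disjoint (A i) (A j)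
  hyperbranching : ∀ i, (D.restrictArcs (A i) (hA i)).IsHyperbranching (rootSet R i)
  regular : ∀ v ∈ D.verts, #{i | v ∈ (D.restrictArcs (A i) (hA i)).core (rootSet R i)} = h

theorem isArcPacking_empty {D : FinDypergraph V ε} {R : Finset (K × V)}
    (hR : ∀ i, rootSet R i ⊆ D.verts) (hcard : ∀ v ∈ D.verts, #(rootColours R {v}) = h) :
    D.IsArcPacking h R (fun _ => ∅) fun _ => empty_subset _ where
  disjoint _ _ _ := disjoint_empty_left _
  hyperbranching i := isHyperbranching_of_arcs_eq_empty rfl (hR i)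
  regular v hv := by
    rw [← hcard v hv]
    congr 1
    ext i
    simp [core, restrictArcs, mem_rootSet, mem_rootColours_singleton]

variable {D : FinDypergraph V ε} {R : Finset (K × V)}

theorem IsArcPacking.insert_arc {a : ε} {j : K} {u : V} {A : K → Finset ε}
    {hA : ∀ i, A i ⊆ D.arcs} (hP : D.IsArcPacking h (insert (j, D.head a) R) A hA)
    (haD : a ∈ D.arcs) (haA : ∀ i, a ∉ A i) (hja : (j, D.head a) ∉ R) (hut : u ∈ D.tails a)
    (hju : (j, u) ∈ R) :
    ∃ A' hA', D.IsArcPacking h R A' hA' := by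
  classical
  let A' : K → Finset ε := Function.update A j (insert a (A j))
  have hA' (i : K) : A' i ⊆ D.arcs := by
    obtain rfl | hi := eq_or_ne i j
    · simpa [A'] using insert_subset haD (hA i)
    · simpa [A', hi] using hA i
  have hself : A' j = insert a (A j) := Function.update_self ..
  have hother (i : K) (hi : i ≠ j) : A' i = A i := Function.update_of_ne hi ..
  have hcore (i : K) : (D.restrictArcs (A' i) (hA' i)).core (rootSet R i) =
      (D.restrictArcs (A i) (hA i)).core (rootSet (insert (j, D.head a) R) i) := by
    obtain rfl | hi := eq_or_ne i j
    · simp only [hself, rootSet_insert_self, core_restrictArcs_insert (hA := hA i)]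
    · simp only [hother i hi, rootSet_insert_of_ne R hi]
  refine ⟨A', hA', fun i i' hii' => ?_, fun i => ?_, fun v hv => ?_⟩
  · have hd := hP.disjoint i i' hii'
    obtain rfl | hi := eq_or_ne i j
    · rw [hself, hother i' hii'.symm]
      exact disjoint_insert_left.2 ⟨haA i', hd⟩
    · rw [hother i hi]
      obtain rfl | hi' := eq_or_ne i' j
      · rw [hself]
        exact disjoint_insert_right.2 ⟨haA i, hd⟩
      · rwa [hother i' hi']
  · have hB := hP.hyperbranching i
    obtain rfl | hi := eq_or_ne i j
    · simp only [hself]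
      rw [rootSet_insert_self] at hB
      exact hB.insert_arc haD (haA i) (mt mem_rootSet.1 hja) hut (mem_rootSet.2 hju)
    · simpa only [hother i hi, rootSet_insert_of_ne R hi] using hB
  · simpa only [hcore] using hP.regular v hv

theorem CutCondition.exists_isArcPacking (hD : D.CutCondition h R)
    (hR : ∀ i, rootSet R i ⊆ D.verts) (hle : ∀ v ∈ D.verts, #(rootColours R {v}) ≤ h) :
    ∃ A hA, D.IsArcPacking h R A hA := by
  classical
  induction hn : #D.arcs using Nat.strong_induction_on generalizing D R with
  | _ n ih =>
    by_cases hfull : ∀ v ∈ D.verts, h ≤ #(rootColours R {v})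
    · exact ⟨_, _, isArcPacking_empty hR fun v hv => (hle v hv).antisymm (hfull v hv)⟩
    push Not at hfull
    obtain ⟨v, hv, hvh⟩ := hfull
    obtain ⟨a, haD, hah, u, hut, j, hju, hja, hcut⟩ := hD.exists_arc_to_root hv hvh
    have hR' (i : K) : rootSet (insert (j, D.head a) R) i ⊆ D.verts := by
      obtain rfl | hi := eq_or_ne i j
      · exact (rootSet_insert_self R i _).trans_subset (insert_subset (D.head_mem a haD) (hR i))
      · exact (rootSet_insert_of_ne R hi _).trans_subset (hR i)
    have hle' (w : V) (hw : w ∈ D.verts) : #(rootColours (insert (j, D.head a) R) {w}) ≤ h := by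
      by_cases hwa : D.head a = w
      · rw [rootColours_insert_of_mem R j (mem_singleton.2 hwa), ← hwa]
        exact (card_insert_le _ _).trans hah
      · rw [rootColours_insert_of_notMem R j (mt mem_singleton.1 hwa)]
        exact hle w hw
    obtain ⟨A, hA, hP⟩ := ih _ (hn ▸ card_erase_lt_of_mem haD) hcut hR' hle' rfl
    have hAD (i : K) : A i ⊆ D.arcs := (hA i).trans (erase_subset _ _)
    have hP' : D.IsArcPacking h (insert (j, D.head a) R) A hAD :=
      ⟨hP.disjoint, hP.hyperbranching, hP.regular⟩
    exact hP'.insert_arc haD (fun i hai => notMem_erase _ _ (hA i hai)) hja hut hju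

end FinDypergraph

/-! ### Necessity of the partition condition -/

theorem IsDipathTo.exists_entering {V ε : Type*} {S X : Finset V} {A : Finset ε}
    {tail head : ε → V} {v : V} {p : List ε} (hp : IsDipathTo S A tail head v p)
    (hSX : Disjoint S X) (hv : v ∈ X) : ∃ a ∈ A, head a ∈ X ∧ tail a ∉ X := by
  induction p generalizing v with
  | nil => exact absurd hv (Finset.disjoint_left.1 hSX hp)
  | cons a p ih =>
    obtain ⟨ha, rfl, hp⟩ := hp
    by_cases htail : tail a ∈ X
    · exact ih hp htail
    · exact ⟨a, ha, hv, htail⟩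

open Finset in
theorem card_filter_parts_inter_nonempty_le {V : Type*} [DecidableEq V] {U : Finset V}
    (P : Finpartition U) (S : Finset V) : #{X ∈ P.parts | (S ∩ X).Nonempty} ≤ #S := by
  refine card_le_card_of_forall_subsingleton (fun X v => v ∈ X) (fun X hX => ?_) ?_
  · obtain ⟨v, hv⟩ := (mem_filter.1 hX).2
    exact ⟨v, mem_inter.1 hv⟩
  · rintro v - X ⟨hX, hvX⟩ Y ⟨hY, hvY⟩
    exact P.eq_of_mem_parts (mem_filter.1 hX).1 (mem_filter.1 hY).1 hvX hvY

namespace FinDypergraph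

open Finset

variable {V ε : Type*} [DecidableEq V] {D : FinDypergraph V ε} {S X : Finset V} {v : V}

theorem IsHyperbranching.enter_nonempty (hD : D.IsHyperbranching S) (hv : v ∈ D.core S)
    (hvX : v ∈ X) (hSX : Disjoint S X) : (D.enter X).Nonempty := by
  obtain ⟨-, tail, htail, -, -, hpath⟩ := hD
  obtain ⟨p, hp, -⟩ := hpath v hv
  obtain ⟨a, ha, hhead, haX⟩ := hp.exists_entering hSX hvX
  exact ⟨a, mem_enter.2 ⟨ha, hhead, fun htails => haX (htails (htail a ha))⟩⟩

end FinDypergraph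

namespace FinHypergraph

open Finset

variable {V ε : Type*} [DecidableEq V] {G : FinHypergraph V ε} {D : FinDypergraph V ε}
  {F : Finset (Finset V)} {X : Finset V}

/-- The hyperedges that enter some member of the family `F`, so that `G.crossing P` is the number of
hyperedges crossing `P.parts`. -/
def crossingEdges (G : FinHypergraph V ε) (F : Finset (Finset V)) : Finset ε :=
  {e ∈ G.edges | ∃ X ∈ F, (G.ends e ∩ X).Nonempty ∧ (G.ends e \ X).Nonempty}

theorem IsOrientation.enter_subset_crossingEdges (hD : G.IsOrientation D) (hX : X ∈ F) :
    D.enter X ⊆ G.crossingEdges F := fun e he => by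
  obtain ⟨-, harcs, horient⟩ := hD
  obtain ⟨heD, hhead, htails⟩ := FinDypergraph.mem_enter.1 he
  have heG : e ∈ G.edges := harcs ▸ heD
  rw [(horient e heG).2] at htails
  exact mem_filter.2 ⟨heG, X, hX, ⟨D.head e, mem_inter.2 ⟨(horient e heG).1, hhead⟩⟩,
    sdiff_nonempty.2 fun h => htails ((erase_subset _ _).trans h)⟩

theorem IsOrientation.sum_card_enter_le (hD : G.IsOrientation D)
    (hF : (F : Set (Finset V)).PairwiseDisjoint id) :
    ∑ X ∈ F, #(D.enter X) ≤ #(G.crossingEdges F) := by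
  classical
  have hdisj : (F : Set (Finset V)).PairwiseDisjoint D.enter := fun X hX Y hY hXY =>
    disjoint_left.2 fun e heX heY => disjoint_left.1 (hF hX hY hXY)
      (FinDypergraph.mem_enter.1 heX).2.1 (FinDypergraph.mem_enter.1 heY).2.1
  rw [← card_biUnion hdisj]
  exact card_le_card (biUnion_subset.2 fun X hX => hD.enter_subset_crossingEdges hX)

theorem IsSubhypergraph.crossingEdges_subset {B : FinHypergraph V ε} (hB : B.IsSubhypergraph G) :
    B.crossingEdges F ⊆ G.crossingEdges F := fun e he => by
  obtain ⟨heB, hcross⟩ := mem_filter.1 he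
  exact mem_filter.2 ⟨hB.2.1 heB, hB.2.2 e heB ▸ hcross⟩

namespace IsRegularPacking

variable {h k : ℕ} {B : Fin k → FinHypergraph V ε} {S : Fin k → Finset V}

theorem roots_subset (hp : G.IsRegularPacking h B S) (i : Fin k) : S i ⊆ G.verts := by
  obtain ⟨D, ⟨hverts, -, -⟩, hD⟩ := hp.hyperforest i
  exact hD.1.trans (hverts ▸ (hp.sub i).1)

theorem sum_card_roots_le (hp : G.IsRegularPacking h B S) : ∑ i, #(S i) ≤ h * #G.verts := by
  obtain ⟨D, -, hreg⟩ := hp.regular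
  calc ∑ i, #(S i) ≤ ∑ i, #{v ∈ G.verts | v ∈ (D i).core (S i)} :=
        sum_le_sum fun i _ => card_le_card fun v hv =>
          mem_filter.2 ⟨hp.roots_subset i hv, mem_union_right _ hv⟩
    _ = ∑ v ∈ G.verts, #{i | v ∈ (D i).core (S i)} :=
        (sum_card_bipartiteAbove_eq_sum_card_bipartiteBelow fun v i => v ∈ (D i).core (S i)).symm
    _ = h * #G.verts := by rw [sum_congr rfl hreg, sum_const, smul_eq_mul, mul_comm]

theorem sum_card_crossingEdges_le (hp : G.IsRegularPacking h B S) (F : Finset (Finset V)) :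
    ∑ i, #((B i).crossingEdges F) ≤ #(G.crossingEdges F) := by
  classical
  have hdisj (i j : Fin k) (hij : i ≠ j) :
      Disjoint ((B i).crossingEdges F) ((B j).crossingEdges F) :=
    (hp.disjoint i j hij).mono (filter_subset _ _) (filter_subset _ _)
  rw [← card_biUnion fun i _ j _ => hdisj i j]
  exact card_le_card (biUnion_subset.2 fun i _ => (hp.sub i).crossingEdges_subset)

theorem le_crossing (hp : G.IsRegularPacking h B S) (P : Finpartition G.verts) :
    h * #P.parts ≤ ∑ i, min #(S i) #P.parts + G.crossing P := by
  obtain ⟨D, hD, hreg⟩ := hp.regular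
  have hpart (X : Finset V) (hX : X ∈ P.parts) :
      h ≤ #{i | (S i ∩ X).Nonempty} + ∑ i, #((D i).enter X) := by
    obtain ⟨v, hv⟩ := P.nonempty_of_mem_parts hX
    rw [← hreg v (P.le hX hv), card_filter, card_filter, ← sum_add_distrib]
    refine sum_le_sum fun i _ => ?_
    split_ifs with hcore hmeet
    · exact Nat.le_add_right _ _
    · rw [not_nonempty_iff_eq_empty, ← disjoint_iff_inter_eq_empty] at hmeet
      exact (card_pos.2 ((hD i).2.enter_nonempty hcore hv hmeet)).trans_le (Nat.le_add_left _ _)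
    · exact Nat.zero_le _
    · exact Nat.zero_le _
  calc h * #P.parts = ∑ _X ∈ P.parts, h := by rw [sum_const, smul_eq_mul, mul_comm]
    _ ≤ ∑ X ∈ P.parts, (#{i | (S i ∩ X).Nonempty} + ∑ i, #((D i).enter X)) := sum_le_sum hpart
    _ = ∑ i, #{X ∈ P.parts | (S i ∩ X).Nonempty} + ∑ i, ∑ X ∈ P.parts, #((D i).enter X) := by
        rw [sum_add_distrib, sum_comm (t := univ)]
        congr 1
        exact sum_card_bipartiteAbove_eq_sum_card_bipartiteBelow fun X i => (S i ∩ X).Nonempty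
    _ ≤ ∑ i, min #(S i) #P.parts + ∑ i, #((B i).crossingEdges P.parts) :=
        add_le_add
          (sum_le_sum fun i _ =>
            le_min (card_filter_parts_inter_nonempty_le P (S i)) (card_filter_le _ _))
          (sum_le_sum fun i _ => (hD i).1.sum_card_enter_le P.disjoint)
    _ ≤ ∑ i, min #(S i) #P.parts + G.crossing P :=
        Nat.add_le_add_left (hp.sum_card_crossingEdges_le P.parts) _

end IsRegularPacking

end FinHypergraph

/-! ### Regular packings with prescribed numbers of roots -/

namespace FinHypergraph

open Finset

variable {V ε : Type*} [DecidableEq V]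

/-- The subhypergraph of `G` on all vertices with set of hyperedges `F`. -/
def restrictEdges (G : FinHypergraph V ε) (F : Finset ε) (hF : F ⊆ G.edges) :
    FinHypergraph V ε where
  verts := G.verts
  edges := F
  ends := G.ends
  ends_subset e he := G.ends_subset e (hF he)
  two_le_card e he := G.two_le_card e (hF he)

variable {G : FinHypergraph V ε}

theorem IsOrientation.restrict {D : FinDypergraph V ε} {F : Finset ε} (hD : G.IsOrientation D)
    (hG : F ⊆ G.edges) (hF : F ⊆ D.arcs) :
    (G.restrictEdges F hG).IsOrientation (D.restrictArcs F hF) :=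
  ⟨hD.1, rfl, fun e he => hD.2.2 e (hG he)⟩

theorem IsOrientation.exists_isRegularPacking {D : FinDypergraph V ε} {h k : ℕ}
    {R : Finset (Fin k × V)} {A : Fin k → Finset ε} {hA : ∀ i, A i ⊆ D.arcs}
    (hD : G.IsOrientation D) (hP : D.IsArcPacking h R A hA) :
    ∃ B, G.IsRegularPacking h B (rootSet R) := by
  have hAG (i : Fin k) : A i ⊆ G.edges := (hA i).trans hD.2.1.subset
  have horient (i : Fin k) := hD.restrict (hAG i) (hA i)
  exact ⟨fun i => G.restrictEdges (A i) (hAG i),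
    { sub := fun i => ⟨subset_rfl, hAG i, fun _ _ => rfl⟩
      disjoint := hP.disjoint
      hyperforest := fun i => ⟨_, horient i, hP.hyperbranching i⟩
      regular := ⟨_, fun i => ⟨horient i, hP.hyperbranching i⟩,
        fun v hv => hP.regular v (hD.1.symm ▸ hv)⟩ }⟩

theorem exists_isRegularPacking_card_eq_iff [Nonempty V] (G : FinHypergraph V ε) (h : ℕ) {k : ℕ}
    (n : Fin k → ℕ) :
    (∃ B S, G.IsRegularPacking h B S ∧ ∀ i, #(S i) = n i) ↔
      (∀ i, n i ≤ #G.verts) ∧ ∑ i, n i ≤ h * #G.verts ∧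
        ∀ P : Finpartition G.verts, h * #P.parts ≤ ∑ i, min (n i) #P.parts + G.crossing P := by
  constructor
  · rintro ⟨B, S, hp, hS⟩
    simp only [← hS]
    exact ⟨fun i => card_le_card (hp.roots_subset i), hp.sum_card_roots_le, hp.le_crossing⟩
  · rintro ⟨hn, hsum, hP⟩
    obtain ⟨R₀, hR₀, hdemand⟩ := G.exists_roots_maxPartitionSum_demand_le h hn hP
    obtain ⟨D, hD, hcut₀⟩ := G.exists_isOrientation_cutCondition hdemand
    rw [← hD.1] at hn hsum
    obtain ⟨R, hR, hcut, hle⟩ := hcut₀.exists_balanced_card_eq (hD.1 ▸ hR₀) hn hsum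
    obtain ⟨A, hA, hA'⟩ := hcut.exists_isArcPacking (fun i => (hR i).1) hle
    obtain ⟨B, hB⟩ := hD.exists_isRegularPacking hA'
    exact ⟨B, rootSet R, hB, fun i => (hR i).2⟩

end FinHypergraph

/-- The functions `ℓ`, `ℓ'` are defined on `{0, 1, …, k}`; `i.succ` for `i : Fin k` runs through
`1, …, k`. -/
theorem mainTheorem1 {V ε : Type*} [DecidableEq V]
    (G : FinHypergraph V ε) (h k : ℕ) (hh : 0 < h) (hk : 0 < k)
    (ℓ ℓ' : Fin (k + 1) → ℕ) (hℓ : ∀ i, 0 < ℓ i) (hℓ' : ∀ i, 0 < ℓ' i)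
    (h_total : ℓ' 0 ≤ ∑ i : Fin k, ℓ' i.succ ∧ ℓ 0 ≤ ℓ' 0 ∧ ∑ i : Fin k, ℓ i.succ ≤ ℓ 0)
    (h_each : ∀ i : Fin k, ℓ' i.succ ≤ G.verts.card ∧ ℓ i.succ ≤ ℓ' i.succ) :
    (∃ (B : Fin k → FinHypergraph V ε) (S : Fin k → Finset V),
        G.IsRegularPacking h B S ∧
        (∀ i : Fin k, ℓ i.succ ≤ (S i).card ∧ (S i).card ≤ ℓ' i.succ) ∧
        ℓ 0 ≤ ∑ i : Fin k, (S i).card ∧ ∑ i : Fin k, (S i).card ≤ ℓ' 0) ↔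
      (ℓ 0 ≤ h * G.verts.card ∧
        (∀ P : Finpartition G.verts,
          (h : ℤ) * P.parts.card ≤
            (ℓ' 0 : ℤ) - (∑ i : Fin k, (ℓ i.succ : ℤ)) +
              (∑ i : Fin k, ((min (ℓ i.succ) P.parts.card : ℕ) : ℤ)) + G.crossing P) ∧
        (∀ P : Finpartition G.verts,
          h * P.parts.card ≤
            (∑ i : Fin k, min (ℓ' i.succ) P.parts.card) + G.crossing P)) := by
  obtain ⟨v, -⟩ := Finset.card_pos.1 ((hℓ' _).trans_le (h_each ⟨0, hk⟩).1)
  have : Nonempty V := ⟨v⟩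
  have hsizes := exists_sizes_iff (h := h) (fun i => (h_each i).2) (fun i => (h_each i).1)
    (fun P : Finpartition G.verts => P.card_parts_le_card) h_total.2.2 h_total.2.1 h_total.1
    (e := G.crossing)
  have hcast (P : Finpartition G.verts) :
      (h : ℤ) * P.parts.card ≤ (ℓ' 0 : ℤ) - (∑ i : Fin k, (ℓ i.succ : ℤ)) +
          (∑ i : Fin k, ((min (ℓ i.succ) P.parts.card : ℕ) : ℤ)) + G.crossing P ↔
        h * P.parts.card + ∑ i : Fin k, ℓ i.succ ≤
          ℓ' 0 + ∑ i : Fin k, min (ℓ i.succ) P.parts.card + G.crossing P := by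
    rw [← Nat.cast_sum, ← Nat.cast_sum]
    lia
  simp only [hcast, ← hsizes]
  constructor
  · rintro ⟨B, S, hp, hS, hlow, hupp⟩
    obtain ⟨-, hsum, hP⟩ := (G.exists_isRegularPacking_card_eq_iff h _).1 ⟨B, S, hp, fun _ => rfl⟩
    exact ⟨fun i => (S i).card, hS, hlow, hupp, hsum, hP⟩
  · rintro ⟨n, hn, hlow, hupp, hsum, hP⟩
    obtain ⟨B, S, hp, hS⟩ := (G.exists_isRegularPacking_card_eq_iff h n).2
      ⟨fun i => (hn i).2.trans (h_each i).1, hsum, hP⟩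
    simp only [← hS] at hn hlow hupp
    exact ⟨B, S, hp, hn, hlow, hupp⟩
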